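/- Let $E$ be a real Euclidean plane with a complex structure $J$ (an orthogonal map with $J^T=-J$), let $(\xi,\eta)$ be an orthonormal basis of $E$ with $J\xi=-\eta$, $J\eta=\xi$, and let $(x,y)$ be the dual basis of $E^*$. Let $m\ge 1$ and let $G\subset \mathrm{O}(E)$ be a dihedral reflection group of order $2m$, that is, a group generated by reflections and isomorphic to the dihedral group of order $2m$; let $\mathcal S$ be its set of reflections, and for $s\in\mathcal S$ let $\alpha_s\in E$ and $a_s\in E^*$ be $-1$ eigenvectors of $s$. Let $c:\mathcal S\to\mathbb C$ be invariant under conjugation by $G$. Let $H_c(G,E)$ be the rational Cherednik algebra, i.e. the quotient of $T(E_{\mathbb C}\oplus E_{\mathbb C}^*)\rtimes\mathbb C[G]$ by the relations $$[\xi_1,\xi_2]=0,\qquad [x_1,x_2]=0,\qquad [\xi_1,x_1]=\langle x_1,\xi_1\rangle-2\sum_{s\in\mathcal S}\frac{\langle x_1,\alpha_s\rangle\langle a_s,\xi_1\rangle}{\langle a_s,\alpha_s\rangle}\,c(s)\,s$$ for $\xi_1,\xi_2\in E$ and $x_1,x_2\in E^*$. Put $\sigma=\sum_{s\in\mathcal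 S}c(s)s$ and $$E_+=\tfrac12(x^2+y^2),\quad E_-=-\tfrac12(\xi^2+\eta^2),\quad H=x\xi+y\eta+1-\sigma,\quad Z_0=i(x\eta-y\xi),$$ and for $\epsilon\in\mathbb R$ let $\mathfrak u(1,1)\subset H_c(G,E)$ be the Lie subalgebra (for the commutator bracket) generated by $E_+$, $E_-$, $H$ and the central element $\tilde Z_0=Z_0+\epsilon\sigma$. Let $G^J$ be the subgroup of the elements of $G$ that commute with $J$. Then the centraliser of $\mathfrak u(1,1)$ in $H_c(G,E)$ is the complex associative subalgebra generated by $\tilde Z_0$ and $\mathbb C[G^J]$. Moreover, $G^J$ is the subgroup of rotations in $G$ (the elements of determinant $1$), and it is cyclic of order $m$. -/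

import Mathlib

noncomputable section

namespace Cherednik

variable {E : Type*} [NormedAddCommGroup E] [InnerProductSpace ℝ E]

/-- An orthogonal transformation is a reflection if it is the orthogonal reflection in the
hyperplane perpendicular to some nonzero vector. -/
def IsReflection (g : E ≃ₗᵢ[ℝ] E) : Prop :=
  ∃ v : E, v ≠ 0 ∧ g = (Submodule.span ℝ {v})ᗮ.reflection

/-- The set `𝒮` of reflections contained in `G`. -/
def reflections (G : Subgroup (E ≃ₗᵢ[ℝ] E)) : Set G :=
  {s | IsReflection (s : E ≃ₗᵢ[ℝ] E)}

/-- `G` is generated by the reflections which it contains. -/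
def IsGeneratedByReflections (G : Subgroup (E ≃ₗᵢ[ℝ] E)) : Prop :=
  Subgroup.closure (reflections G) = ⊤

/-- A chosen root `α_s`, i.e. a `-1` eigenvector of `s` in `E`. The corresponding
`-1` eigenvector `a_s` of `s` in the dual space is `⟪α_s, ·⟫`. -/
def root {G : Subgroup (E ≃ₗᵢ[ℝ] E)} (s : reflections G) : E :=
  Classical.choose s.2

theorem root_ne_zero {G : Subgroup (E ≃ₗᵢ[ℝ] E)} (s : reflections G) : root s ≠ 0 :=
  (Classical.choose_spec s.2).1

theorem apply_root {G : Subgroup (E ≃ₗᵢ[ℝ] E)} (s : reflections G) :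
    ((s : G) : E ≃ₗᵢ[ℝ] E) (root s) = -root s := by
  rw [(Classical.choose_spec s.2).2]
  exact Submodule.reflection_orthogonalComplement_singleton_eq_neg (root s)

/-- The functional `a_s = ⟪α_s, ·⟫`. -/
def coroot {G : Subgroup (E ≃ₗᵢ[ℝ] E)} (s : reflections G) : Module.Dual ℝ E :=
  innerₗ E (root s)

/-- The contragredient action of an orthogonal transformation on the dual space. -/
def contragredient (g : E ≃ₗᵢ[ℝ] E) (x : Module.Dual ℝ E) : Module.Dual ℝ E :=
  x ∘ₗ (g⁻¹ : E ≃ₗᵢ[ℝ] E).toLinearEquiv.toLinearMap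

/-- Generators: vectors `ξ ∈ E`, covectors `x ∈ E*` and group elements `g ∈ G`. -/
inductive Gen (G : Subgroup (E ≃ₗᵢ[ℝ] E))
  | vec (ξ : E)
  | cov (x : Module.Dual ℝ E)
  | grp (g : G)

/-- The generator of the free algebra belonging to a vector. -/
def fvec (G : Subgroup (E ≃ₗᵢ[ℝ] E)) (ξ : E) : FreeAlgebra ℂ (Gen G) :=
  FreeAlgebra.ι ℂ (Gen.vec ξ)

/-- The generator of the free algebra belonging to a covector. -/
def fcov (G : Subgroup (E ≃ₗᵢ[ℝ] E)) (x : Module.Dual ℝ E) : FreeAlgebra ℂ (Gen G) :=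
  FreeAlgebra.ι ℂ (Gen.cov x)

/-- The generator of the free algebra belonging to a group element. -/
def fgrp {G : Subgroup (E ≃ₗᵢ[ℝ] E)} (g : G) : FreeAlgebra ℂ (Gen G) :=
  FreeAlgebra.ι ℂ (Gen.grp g)

/-- The defining relations. The constructors up to `grp_cov` present the semidirect product
`T(E_ℂ ⊕ E*_ℂ) ⋊ ℂ[G]` (a complex algebra with real-linear maps from `E` and `E*` is the same
as one with complex-linear maps from `E_ℂ` and `E*_ℂ`); the last three are the relations of
the rational Cherednik algebra. -/
inductive Rel (G : Subgroup (E ≃ₗᵢ[ℝ] E)) (c : reflections G → ℂ) :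
    FreeAlgebra ℂ (Gen G) → FreeAlgebra ℂ (Gen G) → Prop
  | vec_add (ξ η : E) : Rel G c (fvec G (ξ + η)) (fvec G ξ + fvec G η)
  | vec_smul (r : ℝ) (ξ : E) : Rel G c (fvec G (r • ξ)) ((r : ℂ) • fvec G ξ)
  | cov_add (x y : Module.Dual ℝ E) : Rel G c (fcov G (x + y)) (fcov G x + fcov G y)
  | cov_smul (r : ℝ) (x : Module.Dual ℝ E) : Rel G c (fcov G (r • x)) ((r : ℂ) • fcov G x)
  | grp_one : Rel G c (fgrp 1) 1
  | grp_mul (g h : G) : Rel G c (fgrp (g * h)) (fgrp g * fgrp h)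
  | grp_vec (g : G) (ξ : E) :
      Rel G c (fgrp g * fvec G ξ) (fvec G ((g : E ≃ₗᵢ[ℝ] E) ξ) * fgrp g)
  | grp_cov (g : G) (x : Module.Dual ℝ E) :
      Rel G c (fgrp g * fcov G x) (fcov G (contragredient (g : E ≃ₗᵢ[ℝ] E) x) * fgrp g)
  | vec_comm (ξ η : E) : Rel G c (fvec G ξ * fvec G η) (fvec G η * fvec G ξ)
  | cov_comm (x y : Module.Dual ℝ E) : Rel G c (fcov G x * fcov G y) (fcov G y * fcov G x)
  | vec_cov (ξ : E) (x : Module.Dual ℝ E) :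
      Rel G c (fvec G ξ * fcov G x - fcov G x * fvec G ξ)
        (algebraMap ℂ _ ((x ξ : ℝ) : ℂ) -
          (2 : ℂ) • ∑ᶠ s : reflections G,
            (((x (root s) * coroot s ξ / coroot s (root s) : ℝ) : ℂ) * c s) • fgrp (s : G))

/-- The rational Cherednik algebra `H_c(G, E)` (at `t = 1`), for a finite subgroup `G` of the
orthogonal group of `E`. -/
abbrev RCA (G : Subgroup (E ≃ₗᵢ[ℝ] E)) (c : reflections G → ℂ) : Type _ :=
  RingQuot (Rel G c)

/-- The commutator bracket on `H_c(G, E)`. -/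
instance instLieRing (G : Subgroup (E ≃ₗᵢ[ℝ] E)) (c : reflections G → ℂ) :
    LieRing (RCA G c) :=
  LieRing.ofAssociativeRing

section Elements

variable (G : Subgroup (E ≃ₗᵢ[ℝ] E)) (c : reflections G → ℂ)

/-- The element of `H_c(G, E)` given by a vector. -/
def vec (ξ : E) : RCA G c := RingQuot.mkAlgHom ℂ (Rel G c) (fvec G ξ)

/-- The element of `H_c(G, E)` given by a covector. -/
def cov (x : Module.Dual ℝ E) : RCA G c := RingQuot.mkAlgHom ℂ (Rel G c) (fcov G x)

/-- The canonical homomorphism from `G` to `H_c(G, E)`. -/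
def grp : G →* RCA G c where
  toFun g := RingQuot.mkAlgHom ℂ (Rel G c) (fgrp g)
  map_one' := by
    rw [RingQuot.mkAlgHom_rel ℂ (Rel.grp_one (G := G) (c := c)), map_one]
  map_mul' g h := by
    rw [RingQuot.mkAlgHom_rel ℂ (Rel.grp_mul (c := c) g h), map_mul]

/-- The image in `H_c(G, E)` of the group algebra `ℂ[K]` of a subgroup `K` of `G`. -/
def groupAlgebra (K : Subgroup G) : Subalgebra ℂ (RCA G c) :=
  (MonoidAlgebra.lift ℂ (RCA G c) K ((grp G c).comp K.subtype)).range

/-- The element `σ = ∑ c(s) s`. -/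
def sigma : RCA G c := ∑ᶠ s : reflections G, c s • grp G c (s : G)

variable (b : OrthonormalBasis (Fin 2) ℝ E)

/-- `ξ`, the first basis vector. -/
def elXi : RCA G c := vec G c (b 0)

/-- `η`, the second basis vector. -/
def elEta : RCA G c := vec G c (b 1)

/-- `x`, the first coordinate function. -/
def elX : RCA G c := cov G c (b.toBasis.coord 0)

/-- `y`, the second coordinate function. -/
def elY : RCA G c := cov G c (b.toBasis.coord 1)

/-- `E₊ = (x² + y²)/2`. -/
def Eplus : RCA G c := (1 / 2 : ℂ) • (elX G c b ^ 2 + elY G c b ^ 2)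

/-- `E₋ = -(ξ² + η²)/2`. -/
def Eminus : RCA G c := -((1 / 2 : ℂ) • (elXi G c b ^ 2 + elEta G c b ^ 2))

/-- `H = x ξ + y η + 1 - σ`. -/
def elH : RCA G c := elX G c b * elXi G c b + elY G c b * elEta G c b + 1 - sigma G c

/-- `Z₀ = i (x η - y ξ)`. -/
def Zzero : RCA G c := Complex.I • (elX G c b * elEta G c b - elY G c b * elXi G c b)

/-- `Z₀ + ε σ`. -/
def Ztilde (ε : ℝ) : RCA G c := Zzero G c b + (ε : ℂ) • sigma G c

/-- The realisation of `𝔲(1,1)`: the real Lie subalgebra of `H_c(G, E)` (with the commutator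
bracket) generated by `E₊`, `E₋`, `H` and the central element `Z₀ + ε σ`. -/
def u11 (ε : ℝ) : LieSubalgebra ℝ (RCA G c) :=
  LieSubalgebra.lieSpan ℝ (RCA G c) {Eplus G c b, Eminus G c b, elH G c b, Ztilde G c b ε}

end Elements

/-- A complex structure compatible with the Euclidean structure: an orthogonal `J` with
`Jᵀ = -J` (hence `J² = -1` and `det J = 1`). -/
def IsComplexStructure (J : E →ₗ[ℝ] E) : Prop :=
  (∀ u v : E, inner ℝ (J u) (J v) = inner ℝ u v) ∧
    ∀ u v : E, inner ℝ (J u) v = -inner ℝ u (J v)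

/-- The subgroup `G^J` of the elements of `G` commuting with `J`. -/
def commutingSubgroup (G : Subgroup (E ≃ₗᵢ[ℝ] E)) (J : E →ₗ[ℝ] E) : Subgroup G where
  carrier := {g | ∀ v : E, (g : E ≃ₗᵢ[ℝ] E) (J v) = J ((g : E ≃ₗᵢ[ℝ] E) v)}
  one_mem' := fun _ => rfl
  mul_mem' := by
    intro g h hg hh v
    change (g : E ≃ₗᵢ[ℝ] E) ((h : E ≃ₗᵢ[ℝ] E) (J v))
      = J ((g : E ≃ₗᵢ[ℝ] E) ((h : E ≃ₗᵢ[ℝ] E) v))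
    rw [hh v, hg]
  inv_mem' := by
    intro g hg v
    change (g : E ≃ₗᵢ[ℝ] E).symm (J v) = J ((g : E ≃ₗᵢ[ℝ] E).symm v)
    rw [LinearIsometryEquiv.symm_apply_eq, hg, LinearIsometryEquiv.apply_symm_apply]

end Cherednik

end

/-! Commutation with `E₊` and `E₋` makes 𝔰𝔩₂ act on the Cherednik algebra by derivations. The
elements x, y, ξ, η span two copies of the standard representation, and ℂ[G] is killed. For
commuting variables, invariant theory of SL₂ says that the invariants are generated over ℂ[G] by z =
xη - yξ. This survives noncommutativity through the Casimir operator C. By Capelli's identity, on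
words of length n it acts as n(n+2), up to multiples of z by shorter words and up to lower order
(`casimirOp_sub_mem`). Since C commutes with multiplication by z and kills the algebra generated by
z and ℂ[G], each w has a polynomial T with T(0) ≠ 0 and T(C)w in that algebra (`exists_aeval_mem`).
If w is invariant then T(C)w = T(0)w, so w itself lies there (`mem_adjoin_of_commute`). The element
H needs no separate treatment, being [E₊, E₋].

It remains to find what commutes with Z̃₀ = Z₀ + εσ. Rotations commute with Z₀ and reflections
anticommute with it, so Ω = Z₀² + σ² commutes with G and Z₀, and Z̃₀² = Ω + (ε² - 1)σ². Every
element of the algebra generated by Z₀ and ℂ[G] therefore has the form ∑ (P_g(Ω) + Q_g(Ω) Z̃₀) g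
(`exists_normal_form`). The sum over rotations lies in the desired algebra, because σ² is a
combination of rotations and hence Ω lies there too. The sum a₁ over the orientation reversing g
satisfies [a₁, Z̃₀] = 2 a₁ Z₀, so a₁ Z₀ = 0 when the whole element centralises Z̃₀.

That a₁ = 0 is checked in the representation by Dunkl operators (`eq_zero_of_mul_opZ_eq_zero`). On
restrictions to an isotropic line, Ω multiplies the n-th coefficient by (∑ c - n)². Applying a₁ to
n-th powers then gives an exponential polynomial in n that vanishes for large n, and this forces
every P_g and Q_g in a₁ to be zero. Neither the PBW theorem nor uniqueness of the normal form is
needed. -/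

noncomputable section

namespace Cherednik

/-! ### Invariants of 𝔰𝔩₂ through the Casimir operator and Capelli's identity. -/

section Filtration

variable {R : Type*} [Ring R] [Algebra ℂ R]

/-- The right commutator `a ↦ a * u - u * a` as a linear map. -/
def rightComm (u : R) : R →ₗ[ℂ] R := LinearMap.mulRight ℂ u - LinearMap.mulLeft ℂ u

theorem rightComm_apply (u a : R) : rightComm u a = a * u - u * a := by
  simp [rightComm]

theorem rightComm_mul (u a b : R) : rightComm u (a * b) = rightComm u a * b + a * rightComm u b := by
  simp only [rightComm_apply]; noncomm_ring

/-- An algebra generated by a subalgebra `K` and four elements `x`, `y`, `ξ`, `η` which commute up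
to `K`, and elements `u`, `v` centralising `K` whose commutators act on the span of the four
elements as `𝔰𝔩₂`. -/
structure SlTwoData (K : Subalgebra ℂ R) (x y ξ η u v : R) : Prop where
  span_comm : ∀ k ∈ K, ∀ p ∈ Submodule.span ℂ {x, y, ξ, η},
    k * p ∈ Submodule.span ℂ {x, y, ξ, η} * Subalgebra.toSubmodule K
  xy : x * y = y * x
  ξη : ξ * η = η * ξ
  ξx : ξ * x - x * ξ ∈ K
  ξy : ξ * y - y * ξ ∈ K
  ηx : η * x - x * η ∈ K
  ηy : η * y - y * η ∈ K
  ux : rightComm u x = 0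
  uy : rightComm u y = 0
  uξ : rightComm u ξ = x
  uη : rightComm u η = y
  vx : rightComm v x = ξ
  vy : rightComm v y = η
  vξ : rightComm v ξ = 0
  vη : rightComm v η = 0
  uK : ∀ k ∈ K, rightComm u k = 0
  vK : ∀ k ∈ K, rightComm v k = 0

variable (K : Subalgebra ℂ R) (x y ξ η u v : R)

/-- The span of the products of an element of `K` by at most `n` of the elements
`x`, `y`, `ξ`, `η`. -/
def filtr : ℕ → Submodule ℂ R
  | 0 => Subalgebra.toSubmodule K
  | n + 1 => filtr n ⊔ Submodule.span ℂ {x, y, ξ, η} * filtr n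

/-- `z * F (n - 1) + F n`, where `z = x η - y ξ` and `F` is the filtration `filtr`. -/
def filtrMod : ℕ → Submodule ℂ R
  | 0 => filtr K x y ξ η 0
  | n + 1 => (filtr K x y ξ η n).map (LinearMap.mulLeft ℂ (x * η - y * ξ)) ⊔
      filtr K x y ξ η (n + 1)

/-- The operator `e f - f e`. -/
def weightOp : R →ₗ[ℂ] R :=
  rightComm u ∘ₗ rightComm v - rightComm v ∘ₗ rightComm u

/-- The operator `2 e f + 2 f e + h ^ 2`. -/
def casimirOp : R →ₗ[ℂ] R :=
  (2 : ℂ) • (rightComm u ∘ₗ rightComm v) + (2 : ℂ) • (rightComm v ∘ₗ rightComm u) +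
    weightOp u v ∘ₗ weightOp u v

theorem weightOp_mul (a b : R) :
    weightOp u v (a * b) = weightOp u v a * b + a * weightOp u v b := by
  simp only [weightOp, LinearMap.sub_apply, LinearMap.comp_apply, rightComm_mul, map_add]
  noncomm_ring

/-- The Casimir operator is of second order in derivations, so the product rule acquires a cross
term, the polarised Casimir form. Multiplying by a generator therefore shifts the eigenvalue. -/
theorem casimirOp_mul (a b : R) :
    casimirOp u v (a * b) = casimirOp u v a * b + a * casimirOp u v b
      + (2 : ℂ) • ((2 : ℂ) • (rightComm u a * rightComm v b)
        + (2 : ℂ) • (rightComm v a * rightComm u b) + weightOp u v a * weightOp u v b) := by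
  simp only [casimirOp, LinearMap.add_apply, LinearMap.smul_apply, LinearMap.comp_apply,
    weightOp_mul, rightComm_mul, map_add, add_mul, mul_add, smul_add, smul_mul_assoc,
    mul_smul_comm]
  module

theorem filtr_mono_succ (n : ℕ) : filtr K x y ξ η n ≤ filtr K x y ξ η (n + 1) := le_sup_left

theorem mul_mem_filtr {p w : R} {n : ℕ} (hp : p ∈ Submodule.span ℂ {x, y, ξ, η})
    (hw : w ∈ filtr K x y ξ η n) : p * w ∈ filtr K x y ξ η (n + 1) :=
  Submodule.mem_sup_right (Submodule.mul_mem_mul hp hw)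

variable {K x y ξ η u v}

theorem filtr_succ_induction {n : ℕ} {S : Submodule ℂ R}
    (h0 : ∀ w ∈ filtr K x y ξ η n, w ∈ S)
    (hx : ∀ w ∈ filtr K x y ξ η n, x * w ∈ S) (hy : ∀ w ∈ filtr K x y ξ η n, y * w ∈ S)
    (hξ : ∀ w ∈ filtr K x y ξ η n, ξ * w ∈ S) (hη : ∀ w ∈ filtr K x y ξ η n, η * w ∈ S) :
    filtr K x y ξ η (n + 1) ≤ S := by
  refine sup_le h0 (Submodule.mul_le.2 fun p hp w hw => ?_)
  have : Submodule.span ℂ {x, y, ξ, η} ≤ S.comap (LinearMap.mulRight ℂ w) := by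
    rw [Submodule.span_le]
    rintro q (rfl | rfl | rfl | rfl)
    exacts [hx w hw, hy w hw, hξ w hw, hη w hw]
  exact this hp

theorem x_mem : x ∈ Submodule.span ℂ {x, y, ξ, η} := Submodule.subset_span (by simp)
theorem y_mem : y ∈ Submodule.span ℂ {x, y, ξ, η} := Submodule.subset_span (by simp)
theorem ξ_mem : ξ ∈ Submodule.span ℂ {x, y, ξ, η} := Submodule.subset_span (by simp)
theorem η_mem : η ∈ Submodule.span ℂ {x, y, ξ, η} := Submodule.subset_span (by simp)

theorem filtr_le_filtrMod (n : ℕ) : filtr K x y ξ η n ≤ filtrMod K x y ξ η n := by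
  cases n with
  | zero => exact le_rfl
  | succ n => exact le_sup_right

theorem mul_mem_filtrMod {w : R} {n : ℕ} (hw : w ∈ filtr K x y ξ η n) :
    (x * η - y * ξ) * w ∈ filtrMod K x y ξ η (n + 1) :=
  Submodule.mem_sup_left ⟨w, hw, rfl⟩

namespace SlTwoData

variable (d : SlTwoData K x y ξ η u v)
include d

theorem K_mul_mem {n : ℕ} : ∀ {k w : R}, k ∈ K → w ∈ filtr K x y ξ η n →
    k * w ∈ filtr K x y ξ η n := by
  induction n with
  | zero => exact fun hk hw => K.mul_mem hk hw
  | succ n ih =>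
    intro k w hk hw
    -- An element of K moves past one generator by `span_comm`, and the induction hypothesis absorbs
    -- it into the remaining factor.
    have key : ∀ p ∈ Submodule.span ℂ {x, y, ξ, η}, ∀ w ∈ filtr K x y ξ η n,
        k * (p * w) ∈ filtr K x y ξ η (n + 1) := by
      intro p hp w hw
      have h2 : Submodule.span ℂ {x, y, ξ, η} * Subalgebra.toSubmodule K ≤
          (filtr K x y ξ η (n + 1)).comap (LinearMap.mulRight ℂ w) := by
        refine Submodule.mul_le.2 fun q hq l hl => ?_
        simp only [Submodule.mem_comap, LinearMap.mulRight_apply, mul_assoc]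
        exact mul_mem_filtr _ _ _ _ _ hq (ih hl hw)
      have := h2 (d.span_comm k hk p hp)
      simpa [mul_assoc] using this
    have : filtr K x y ξ η (n + 1) ≤
        (filtr K x y ξ η (n + 1)).comap (LinearMap.mulLeft ℂ k) :=
      filtr_succ_induction (fun w hw => filtr_mono_succ _ _ _ _ _ _ (ih hk hw))
        (key x x_mem) (key y y_mem) (key ξ ξ_mem) (key η η_mem)
    exact this hw

theorem rightComm_u_mem {n : ℕ} : ∀ {w : R}, w ∈ filtr K x y ξ η n →
    rightComm u w ∈ filtr K x y ξ η n := by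
  induction n with
  | zero => intro w hw; rw [d.uK w hw]; exact zero_mem _
  | succ n ih =>
    intro w hw
    have hmul : ∀ p ∈ Submodule.span ℂ {x, y, ξ, η},
        rightComm u p ∈ Submodule.span ℂ {x, y, ξ, η} → ∀ w ∈ filtr K x y ξ η n,
        p * w ∈ (filtr K x y ξ η (n + 1)).comap (rightComm u) := fun p hp hp' w hw => by
      rw [Submodule.mem_comap, rightComm_mul]
      exact add_mem (mul_mem_filtr _ _ _ _ _ hp' hw) (mul_mem_filtr _ _ _ _ _ hp (ih hw))
    refine filtr_succ_induction (S := (filtr K x y ξ η (n + 1)).comap (rightComm u))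
      (fun w hw => filtr_mono_succ _ _ _ _ _ _ (ih hw)) (hmul x x_mem ?_) (hmul y y_mem ?_)
      (hmul ξ ξ_mem ?_) (hmul η η_mem ?_) hw
    · rw [d.ux]; exact zero_mem _
    · rw [d.uy]; exact zero_mem _
    · rw [d.uξ]; exact x_mem
    · rw [d.uη]; exact y_mem

/-- Exchanging the two pairs of variables. -/
theorem swap : SlTwoData K ξ η x y v u where
  span_comm := by
    have : ({ξ, η, x, y} : Set R) = {x, y, ξ, η} := by ext; simp; tauto
    rw [this]; exact d.span_comm
  xy := d.ξη
  ξη := d.xy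
  ξx := by simpa using K.neg_mem d.ξx
  ξy := by simpa using K.neg_mem d.ηx
  ηx := by simpa using K.neg_mem d.ξy
  ηy := by simpa using K.neg_mem d.ηy
  ux := d.vξ
  uy := d.vη
  uξ := d.vx
  uη := d.vy
  vx := d.uξ
  vy := d.uη
  vξ := d.ux
  vη := d.uy
  uK := d.vK
  vK := d.uK

/-- Exchanging the two coordinates. -/
theorem flip : SlTwoData K y x η ξ u v where
  span_comm := by
    have : ({y, x, η, ξ} : Set R) = {x, y, ξ, η} := by ext; simp; tauto
    rw [this]; exact d.span_comm
  xy := d.xy.symm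
  ξη := d.ξη.symm
  ξx := d.ηy
  ξy := d.ηx
  ηx := d.ξy
  ηy := d.ξx
  ux := d.uy
  uy := d.ux
  uξ := d.uη
  uη := d.uξ
  vx := d.vy
  vy := d.vx
  vξ := d.vη
  vη := d.vξ
  uK := d.uK
  vK := d.vK

omit d in
theorem filtr_swap (n : ℕ) : filtr K ξ η x y n = filtr K x y ξ η n := by
  have : ({ξ, η, x, y} : Set R) = {x, y, ξ, η} := by ext; simp; tauto
  induction n with
  | zero => rfl
  | succ n ih => simp only [filtr, ih, this]

omit d in
theorem filtr_flip (n : ℕ) : filtr K y x η ξ n = filtr K x y ξ η n := by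
  have : ({y, x, η, ξ} : Set R) = {x, y, ξ, η} := by ext; simp; tauto
  induction n with
  | zero => rfl
  | succ n ih => simp only [filtr, ih, this]

omit d in
theorem filtrMod_flip (n : ℕ) : filtrMod K y x η ξ n = filtrMod K x y ξ η n := by
  cases n with
  | zero => rfl
  | succ n =>
    have h : LinearMap.mulLeft ℂ (y * ξ - x * η) = -LinearMap.mulLeft ℂ (x * η - y * ξ) := by
      ext w; simp only [LinearMap.mulLeft_apply, LinearMap.neg_apply]; noncomm_ring
    simp only [filtrMod, filtr_flip, h, Submodule.map_neg]

/-- Exchanging the pairs turns z into -z plus commutators in K, which multiply each filtration step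
into itself. -/
theorem filtrMod_swap_le (n : ℕ) : filtrMod K ξ η x y n ≤ filtrMod K x y ξ η n := by
  cases n with
  | zero => exact le_rfl
  | succ n =>
    simp only [filtrMod, filtr_swap]
    refine sup_le ?_ le_sup_right
    rintro _ ⟨w, hw, rfl⟩
    have h : (ξ * y - η * x) * w = -((x * η - y * ξ) * w) +
        ((ξ * y - y * ξ) * w - (η * x - x * η) * w) := by noncomm_ring
    rw [LinearMap.mulLeft_apply, h]
    refine add_mem (neg_mem (Submodule.mem_sup_left ⟨w, hw, rfl⟩))
      (Submodule.mem_sup_right (filtr_mono_succ _ _ _ _ _ _ (sub_mem ?_ ?_)))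
    · exact d.K_mul_mem d.ξy hw
    · exact d.K_mul_mem d.ηx hw

theorem filtrMod_swap (n : ℕ) : filtrMod K ξ η x y n = filtrMod K x y ξ η n :=
  le_antisymm (d.filtrMod_swap_le n) (d.swap.filtrMod_swap_le n)

theorem rightComm_v_mem {n : ℕ} {w : R} (hw : w ∈ filtr K x y ξ η n) :
    rightComm v w ∈ filtr K x y ξ η n := by
  rw [← filtr_swap] at hw ⊢
  exact d.swap.rightComm_u_mem hw

theorem weightOp_mem {n : ℕ} {w : R} (hw : w ∈ filtr K x y ξ η n) :
    weightOp u v w ∈ filtr K x y ξ η n :=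
  sub_mem (d.rightComm_u_mem (d.rightComm_v_mem hw)) (d.rightComm_v_mem (d.rightComm_u_mem hw))

theorem casimirOp_mem {n : ℕ} {w : R} (hw : w ∈ filtr K x y ξ η n) :
    casimirOp u v w ∈ filtr K x y ξ η n :=
  add_mem (add_mem (Submodule.smul_mem _ _ (d.rightComm_u_mem (d.rightComm_v_mem hw)))
    (Submodule.smul_mem _ _ (d.rightComm_v_mem (d.rightComm_u_mem hw))))
    (d.weightOp_mem (d.weightOp_mem hw))

/-- The commutator of x with z is a combination of x and y with coefficients in K, so moving x past
z costs only a term of lower order. The other generators follow by the two symmetries of the data.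
-/
theorem x_mul_filtrMod {n : ℕ} {w : R} (hw : w ∈ filtrMod K x y ξ η n) :
    x * w ∈ filtrMod K x y ξ η (n + 1) := by
  cases n with
  | zero => exact filtr_le_filtrMod _ (mul_mem_filtr _ _ _ _ _ x_mem hw)
  | succ n =>
    obtain ⟨_, ⟨a, ha, rfl⟩, b, hb, rfl⟩ := Submodule.mem_sup.1 hw
    have hxx : x * (y * (ξ * a)) = y * (x * (ξ * a)) := by
      rw [← mul_assoc, d.xy, mul_assoc]
    have h : x * ((x * η - y * ξ) * a + b) = (x * η - y * ξ) * (x * a)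
        + (y * ((ξ * x - x * ξ) * a) - x * ((η * x - x * η) * a)) + x * b := by
      simp only [sub_mul, mul_add, mul_sub, mul_assoc, hxx]
      abel
    rw [LinearMap.mulLeft_apply, h]
    refine add_mem (add_mem (mul_mem_filtrMod (mul_mem_filtr _ _ _ _ _ x_mem ha))
      (filtr_le_filtrMod _ ?_)) (filtr_le_filtrMod _ (mul_mem_filtr _ _ _ _ _ x_mem hb))
    refine filtr_mono_succ _ _ _ _ _ _ (sub_mem ?_ ?_)
    · exact mul_mem_filtr _ _ _ _ _ y_mem (d.K_mul_mem d.ξx ha)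
    · exact mul_mem_filtr _ _ _ _ _ x_mem (d.K_mul_mem d.ηx ha)

theorem y_mul_filtrMod {n : ℕ} {w : R} (hw : w ∈ filtrMod K x y ξ η n) :
    y * w ∈ filtrMod K x y ξ η (n + 1) := by
  rw [← filtrMod_flip] at hw ⊢
  exact d.flip.x_mul_filtrMod hw

theorem ξ_mul_filtrMod {n : ℕ} {w : R} (hw : w ∈ filtrMod K x y ξ η n) :
    ξ * w ∈ filtrMod K x y ξ η (n + 1) := by
  rw [← d.filtrMod_swap] at hw ⊢
  exact d.swap.x_mul_filtrMod hw

theorem η_mul_filtrMod {n : ℕ} {w : R} (hw : w ∈ filtrMod K x y ξ η n) :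
    η * w ∈ filtrMod K x y ξ η (n + 1) := by
  rw [← d.filtrMod_swap] at hw ⊢
  exact d.swap.y_mul_filtrMod hw

theorem weightOp_x : weightOp u v x = x := by
  simp [weightOp, d.vx, d.ux, d.uξ]
theorem weightOp_y : weightOp u v y = y := by
  simp [weightOp, d.vy, d.uy, d.uη]
theorem weightOp_ξ : weightOp u v ξ = -ξ := by
  simp [weightOp, d.vξ, d.uξ, d.vx]
theorem weightOp_η : weightOp u v η = -η := by
  simp [weightOp, d.vη, d.uη, d.vy]

omit d in
theorem weightOp_swap (w : R) : weightOp v u w = -weightOp u v w := by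
  simp [weightOp]

omit d in
theorem casimirOp_swap (w : R) : casimirOp v u w = casimirOp u v w := by
  simp only [casimirOp, LinearMap.add_apply, LinearMap.smul_apply, LinearMap.comp_apply]
  have h : ∀ a, weightOp v u a = -weightOp u v a := weightOp_swap
  rw [h, h, map_neg, neg_neg]
  abel

/-- The polarisation of the Capelli identity. -/
theorem polarisation_mem {n : ℕ} : ∀ {w : R}, w ∈ filtr K x y ξ η n →
    (2 : ℂ) • (ξ * rightComm u w) + x * weightOp u v w - (n : ℂ) • (x * w)
      ∈ filtrMod K x y ξ η n := by
  induction n with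
  | zero =>
    intro w hw
    have h1 := d.uK w hw
    have h2 := d.vK w hw
    simp [weightOp, h1, h2]
  | succ n ih =>
    intro w hw
    -- In commuting variables e = x∂_ξ + y∂_η and h = x∂_x + y∂_y - ξ∂_ξ - η∂_η, so 2ξe + xh - x·deg
    -- = -2z∂_η. The identity `hstep` below is the Leibniz rule for this operator, with the
    -- noncommutative corrections collected in its last summand.
    let L : R →ₗ[ℂ] R := (2 : ℂ) • (LinearMap.mulLeft ℂ ξ ∘ₗ rightComm u)
      + LinearMap.mulLeft ℂ x ∘ₗ weightOp u v - ((n + 1 : ℕ) : ℂ) • LinearMap.mulLeft ℂ x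
    have hL : ∀ w, L w = (2 : ℂ) • (ξ * rightComm u w) + x * weightOp u v w
        - ((n + 1 : ℕ) : ℂ) • (x * w) := fun w => by simp [L]
    have hstep : ∀ p w, L (p * w) = ((2 : ℂ) • (ξ * rightComm u p) + x * weightOp u v p - x * p) * w
        + p * ((2 : ℂ) • (ξ * rightComm u w) + x * weightOp u v w - (n : ℂ) • (x * w))
        + ((2 : ℂ) • ((ξ * p - p * ξ) * rightComm u w) + (x * p - p * x) * weightOp u v w
          - (n : ℂ) • ((x * p - p * x) * w)) := by
      intro p w
      rw [hL, rightComm_mul, weightOp_mul]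
      simp only [sub_mul, mul_add, mul_sub, add_mul, mul_assoc, smul_mul_assoc, mul_smul_comm]
      push_cast
      module
    have hKn : ∀ {k w : R}, k ∈ K → w ∈ filtr K x y ξ η n → k * w ∈ filtrMod K x y ξ η (n + 1) :=
      fun hk hw => filtr_le_filtrMod _ (filtr_mono_succ _ _ _ _ _ _ (d.K_mul_mem hk hw))
    have hrest : ∀ p w, ξ * p - p * ξ ∈ K → x * p - p * x ∈ K → w ∈ filtr K x y ξ η n →
        ((2 : ℂ) • ((ξ * p - p * ξ) * rightComm u w) + (x * p - p * x) * weightOp u v w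
          - (n : ℂ) • ((x * p - p * x) * w)) ∈ filtrMod K x y ξ η (n + 1) :=
      fun p w h1 h2 hw => sub_mem (add_mem
        (Submodule.smul_mem _ _ (hKn h1 (d.rightComm_u_mem hw))) (hKn h2 (d.weightOp_mem hw)))
        (Submodule.smul_mem _ _ (hKn h2 hw))
    have zK : ∀ {a : R}, a = 0 → a ∈ K := fun h => h ▸ K.zero_mem
    rw [← hL]
    refine filtr_succ_induction (S := (filtrMod K x y ξ η (n + 1)).comap L) ?_ ?_ ?_ ?_ ?_ hw
    · intro w hw
      rw [Submodule.mem_comap, hL]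
      refine filtr_le_filtrMod _ (sub_mem (add_mem (Submodule.smul_mem _ _ ?_) ?_)
        (Submodule.smul_mem _ _ ?_))
      · exact mul_mem_filtr _ _ _ _ _ ξ_mem (d.rightComm_u_mem hw)
      · exact mul_mem_filtr _ _ _ _ _ x_mem (d.weightOp_mem hw)
      · exact mul_mem_filtr _ _ _ _ _ x_mem hw
    · intro w hw
      rw [Submodule.mem_comap, hstep]
      refine add_mem (add_mem ?_ (d.x_mul_filtrMod (ih hw)))
        (hrest x w d.ξx (zK (sub_self _)) hw)
      simp [d.ux, d.weightOp_x]
    · intro w hw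
      rw [Submodule.mem_comap, hstep]
      refine add_mem (add_mem ?_ (d.y_mul_filtrMod (ih hw)))
        (hrest y w d.ξy (zK (sub_eq_zero.2 d.xy)) hw)
      simp [d.uy, d.weightOp_y]
    · intro w hw
      rw [Submodule.mem_comap, hstep]
      refine add_mem (add_mem ?_ (d.ξ_mul_filtrMod (ih hw)))
        (hrest ξ w (zK (sub_self _)) (by simpa using K.neg_mem d.ξx) hw)
      have : ((2 : ℂ) • (ξ * rightComm u ξ) + x * weightOp u v ξ - x * ξ) * w
          = (2 : ℂ) • ((ξ * x - x * ξ) * w) := by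
        rw [d.uξ, d.weightOp_ξ]
        simp only [sub_mul, add_mul, mul_neg, neg_mul, smul_mul_assoc, smul_sub]
        module
      rw [this]
      exact Submodule.smul_mem _ _ (hKn d.ξx hw)
    · intro w hw
      rw [Submodule.mem_comap, hstep]
      refine add_mem (add_mem ?_ (d.η_mul_filtrMod (ih hw)))
        (hrest η w (zK (sub_eq_zero.2 d.ξη)) (by simpa using K.neg_mem d.ηx) hw)
      -- Only the generator η contributes z, as the formula -2z∂_η predicts.
      have : ((2 : ℂ) • (ξ * rightComm u η) + x * weightOp u v η - x * η) * w
          = (2 : ℂ) • ((ξ * y - y * ξ) * w - (x * η - y * ξ) * w) := by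
        rw [d.uη, d.weightOp_η]
        simp only [sub_mul, add_mul, mul_neg, neg_mul, smul_mul_assoc, smul_sub]
        module
      rw [this]
      exact Submodule.smul_mem _ _ (sub_mem (hKn d.ξy hw) (mul_mem_filtrMod hw))

/-- The eigenvalue 3 of x, the eigenvalue n(n+2) of w and the cross term 2n from `polarisation_mem`
add up to (n+1)(n+3). -/
theorem casimirOp_x_mul {n : ℕ}
    (ih : ∀ w ∈ filtr K x y ξ η n, x * (casimirOp u v w - ((n : ℂ) * (n + 2)) • w)
      ∈ filtrMod K x y ξ η n) {w : R} (hw : w ∈ filtr K x y ξ η n) :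
    casimirOp u v (x * w) - (((n + 1 : ℕ) : ℂ) * ((n + 1 : ℕ) + 2)) • (x * w)
      ∈ filtrMod K x y ξ η n := by
  have h3 : casimirOp u v x = (3 : ℂ) • x := by
    simp only [casimirOp, LinearMap.add_apply, LinearMap.smul_apply, LinearMap.comp_apply,
      d.weightOp_x, d.ux, d.vx, d.uξ, map_zero]
    module
  have h : casimirOp u v (x * w) - (((n + 1 : ℕ) : ℂ) * ((n + 1 : ℕ) + 2)) • (x * w)
      = x * (casimirOp u v w - ((n : ℂ) * (n + 2)) • w)
      + (2 : ℂ) • ((2 : ℂ) • (ξ * rightComm u w) + x * weightOp u v w - (n : ℂ) • (x * w)) := by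
    rw [casimirOp_mul, h3, d.ux, d.vx, d.weightOp_x]
    simp only [mul_sub, smul_mul_assoc, mul_smul_comm, zero_mul]
    push_cast
    module
  rw [h]
  exact add_mem (ih w hw) (Submodule.smul_mem _ _ (d.polarisation_mem hw))

/-- The Capelli identity up to terms of lower order. -/
theorem casimirOp_sub_mem (n : ℕ) : ∀ w ∈ filtr K x y ξ η (n + 1),
    casimirOp u v w - (((n + 1 : ℕ) : ℂ) * ((n + 1 : ℕ) + 2)) • w ∈ filtrMod K x y ξ η n := by
  -- The induction hypothesis is stated after multiplication by a generator. This lets n = 0, where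
  -- the difference is zero, start the induction without a filtration step of negative index.
  have main : ∀ n : ℕ, (∀ w ∈ filtr K x y ξ η n, ∀ p ∈ ({x, y, ξ, η} : Set R),
      p * (casimirOp u v w - ((n : ℂ) * (n + 2)) • w) ∈ filtrMod K x y ξ η n) →
      ∀ w ∈ filtr K x y ξ η (n + 1),
      casimirOp u v w - (((n + 1 : ℕ) : ℂ) * ((n + 1 : ℕ) + 2)) • w ∈ filtrMod K x y ξ η n := by
    intro n ih w hw
    let L : R →ₗ[ℂ] R := casimirOp u v - (((n + 1 : ℕ) : ℂ) * ((n + 1 : ℕ) + 2)) • LinearMap.id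
    have hL : ∀ w, L w = casimirOp u v w - (((n + 1 : ℕ) : ℂ) * ((n + 1 : ℕ) + 2)) • w :=
      fun w => rfl
    rw [← hL]
    refine filtr_succ_induction (S := (filtrMod K x y ξ η n).comap L) ?_ ?_ ?_ ?_ ?_ hw
    · intro w hw
      exact filtr_le_filtrMod _ (sub_mem (d.casimirOp_mem hw) (Submodule.smul_mem _ _ hw))
    · intro w hw
      exact d.casimirOp_x_mul (fun w hw => ih w hw x (by simp)) hw
    · intro w hw
      have := d.flip.casimirOp_x_mul (n := n) (w := w)
      simp only [filtr_flip, filtrMod_flip] at this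
      exact this (fun w hw => ih w hw y (by simp)) hw
    · intro w hw
      have := d.swap.casimirOp_x_mul (n := n) (w := w)
      simp only [filtr_swap, d.filtrMod_swap, casimirOp_swap] at this
      exact this (fun w hw => ih w hw ξ (by simp)) hw
    · intro w hw
      have := d.swap.flip.casimirOp_x_mul (n := n) (w := w)
      simp only [filtr_flip, filtrMod_flip, filtr_swap, d.filtrMod_swap, casimirOp_swap] at this
      exact this (fun w hw => ih w hw η (by simp)) hw
  induction n with
  | zero =>
    refine main 0 fun w hw p hp => ?_
    have h1 := d.uK w hw
    have h2 := d.vK w hw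
    simp [casimirOp, weightOp, h1, h2]
  | succ n ih =>
    refine main (n + 1) fun w hw p hp => ?_
    have := ih w hw
    rcases hp with rfl | rfl | rfl | rfl
    exacts [d.x_mul_filtrMod this, d.y_mul_filtrMod this, d.ξ_mul_filtrMod this,
      d.η_mul_filtrMod this]

theorem rightComm_u_z : rightComm u (x * η - y * ξ) = 0 := by
  simp [rightComm_mul, d.ux, d.uy, d.uξ, d.uη, d.xy]

theorem rightComm_v_z : rightComm v (x * η - y * ξ) = 0 := by
  simp [rightComm_mul, d.vx, d.vy, d.vξ, d.vη, d.ξη]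

/-- Both derivations kill z, so the cross term in the product rule disappears. -/
theorem casimirOp_z_mul (w : R) :
    casimirOp u v ((x * η - y * ξ) * w) = (x * η - y * ξ) * casimirOp u v w := by
  have h1 := d.rightComm_u_z
  have h2 := d.rightComm_v_z
  have h3 : weightOp u v (x * η - y * ξ) = 0 := by simp only [weightOp, LinearMap.sub_apply,
    LinearMap.comp_apply, h1, h2, map_zero, sub_self]
  have h4 : casimirOp u v (x * η - y * ξ) = 0 := by simp only [casimirOp, LinearMap.add_apply,
    LinearMap.smul_apply, LinearMap.comp_apply, h1, h2, h3, map_zero, smul_zero, add_zero]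
  rw [casimirOp_mul, h1, h2, h3, h4]
  simp

theorem aeval_casimirOp_z_mul (T : Polynomial ℂ) (w : R) :
    Polynomial.aeval (casimirOp u v) T ((x * η - y * ξ) * w)
      = (x * η - y * ξ) * Polynomial.aeval (casimirOp u v) T w := by
  induction T using Polynomial.induction_on generalizing w with
  | C a => simp [Module.algebraMap_end_apply]
  | add p q hp hq => simp [hp, hq, mul_add]
  | monomial n a ih =>
    simp only [pow_succ, ← mul_assoc, map_mul _ _ Polynomial.X, Polynomial.aeval_X,
      Module.End.mul_apply] at ih ⊢
    rw [d.casimirOp_z_mul, ih]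

theorem casimirOp_adjoin {a : R}
    (ha : a ∈ Algebra.adjoin ℂ (insert (x * η - y * ξ) (K : Set R))) :
    casimirOp u v a = 0 := by
  have hc : ∀ w : R, (∀ k ∈ K, rightComm w k = 0) → rightComm w (x * η - y * ξ) = 0 →
      rightComm w a = 0 := by
    intro w hw hz
    have : Algebra.adjoin ℂ (insert (x * η - y * ξ) (K : Set R)) ≤ Subalgebra.centralizer ℂ {w} := by
      refine Algebra.adjoin_le ?_
      rintro q (rfl | hq)
      · rw [rightComm_apply, sub_eq_zero] at hz
        exact (Subalgebra.mem_centralizer_iff ℂ).2 (by simpa using hz.symm)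
      · have := hw q hq
        rw [rightComm_apply, sub_eq_zero] at this
        exact (Subalgebra.mem_centralizer_iff ℂ).2 (by simpa using this.symm)
    have := (Subalgebra.mem_centralizer_iff ℂ).1 (this ha) w rfl
    rw [rightComm_apply, this, sub_self]
  have h1 := hc u d.uK d.rightComm_u_z
  have h2 := hc v d.vK d.rightComm_v_z
  simp [casimirOp, weightOp, h1, h2]

/-- By Capelli's identity the factor C - (n+1)(n+3) sends length n + 1 to multiples of z by shorter
words plus lower order. Finitely many such factors reach the algebra generated by z and K. None of
the roots is 0, which is the only eigenvalue on that algebra. -/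
theorem exists_aeval_mem (n : ℕ) : ∀ w ∈ filtr K x y ξ η n, ∃ T : Polynomial ℂ, T.eval 0 ≠ 0 ∧
    Polynomial.aeval (casimirOp u v) T w ∈
      Algebra.adjoin ℂ (insert (x * η - y * ξ) (K : Set R)) := by
  set A := Algebra.adjoin ℂ (insert (x * η - y * ξ) (K : Set R)) with hA
  have hzA : x * η - y * ξ ∈ A := Algebra.subset_adjoin (Set.mem_insert _ _)
  have hKA : ∀ k ∈ K, k ∈ A := fun k hk => Algebra.subset_adjoin (Set.mem_insert_of_mem _ hk)
  have hstable : ∀ (T : Polynomial ℂ) {a : R}, a ∈ A →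
      Polynomial.aeval (casimirOp u v) T a = T.eval 0 • a := by
    intro T a ha
    induction T using Polynomial.induction_on with
    | C c => simp [Module.algebraMap_end_apply]
    | add p q hp hq => simp [hp, hq, add_smul]
    | monomial n c ih =>
      simp [pow_succ, ← mul_assoc, map_mul _ _ Polynomial.X, Module.End.mul_apply,
        d.casimirOp_adjoin ha]
  have step : ∀ n : ℕ, (∀ w ∈ filtrMod K x y ξ η n, ∃ T : Polynomial ℂ, T.eval 0 ≠ 0 ∧
      Polynomial.aeval (casimirOp u v) T w ∈ A) → ∀ w ∈ filtr K x y ξ η (n + 1),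
      ∃ T : Polynomial ℂ, T.eval 0 ≠ 0 ∧ Polynomial.aeval (casimirOp u v) T w ∈ A := by
    intro n ih w hw
    obtain ⟨T, hT, h⟩ := ih _ (d.casimirOp_sub_mem n w hw)
    -- The new factor acts first and lowers w into `filtrMod`, where T is available. Its root
    -- (n+1)(n+3) is nonzero.
    refine ⟨T * (Polynomial.X - Polynomial.C (((n + 1 : ℕ) : ℂ) * ((n + 1 : ℕ) + 2))), ?_, ?_⟩
    · have h1 : ((n + 1 : ℕ) : ℂ) ≠ 0 := Nat.cast_ne_zero.2 (Nat.succ_ne_zero n)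
      have h2 : ((n + 1 : ℕ) : ℂ) + 2 ≠ 0 := by
        exact_mod_cast Nat.succ_ne_zero (n + 2)
      simp only [Polynomial.eval_mul, Polynomial.eval_sub, Polynomial.eval_X, Polynomial.eval_C,
        zero_sub]
      exact mul_ne_zero hT (neg_ne_zero.2 (mul_ne_zero h1 h2))
    · rwa [map_mul, Module.End.mul_apply, map_sub, Polynomial.aeval_X, Polynomial.aeval_C,
        LinearMap.sub_apply, Module.algebraMap_end_apply]
  have hQ : ∀ n : ℕ, ∀ w ∈ filtrMod K x y ξ η n, ∃ T : Polynomial ℂ, T.eval 0 ≠ 0 ∧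
      Polynomial.aeval (casimirOp u v) T w ∈ A := by
    intro n
    induction n using Nat.strong_induction_on with
    | _ n ih =>
      cases n with
      | zero => exact fun w hw => ⟨1, by simp, by simpa using hKA w hw⟩
      | succ n =>
        intro w hw
        obtain ⟨_, ⟨a, ha, rfl⟩, b, hb, rfl⟩ := Submodule.mem_sup.1 hw
        obtain ⟨T, hT, h1⟩ := step n (ih n n.lt_succ_self) b hb
        obtain ⟨S, hS, h2⟩ := ih n n.lt_succ_self a (filtr_le_filtrMod n ha)
        -- T takes b into A and S takes a into A. The superfluous factor acts on A by its value at
        -- 0, and both commute with multiplication by z.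
        refine ⟨S * T, by simp [hS, hT], ?_⟩
        rw [map_add, LinearMap.mulLeft_apply, d.aeval_casimirOp_z_mul]
        refine add_mem (mul_mem hzA ?_) ?_
        · rw [mul_comm, map_mul, Module.End.mul_apply, hstable _ h2]
          exact Subalgebra.smul_mem _ h2 _
        · rw [map_mul, Module.End.mul_apply, hstable _ h1]
          exact Subalgebra.smul_mem _ h1 _
  exact fun w hw => hQ n w (filtr_le_filtrMod n hw)

/-- The centraliser of the two elements generating `𝔰𝔩₂` is generated by `x η - y ξ` and `K`. -/
theorem mem_adjoin_of_commute (hgen : Algebra.adjoin ℂ ({x, y, ξ, η} ∪ (K : Set R)) = ⊤)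
    {a : R} (hu : a * u = u * a) (hv : a * v = v * a) :
    a ∈ Algebra.adjoin ℂ (insert (x * η - y * ξ) (K : Set R)) := by
  -- The filtration is exhaustive: left multiplication by any element raises the order by a finite
  -- amount. It is applied below to 1.
  have hfil : ∀ r : R, ∀ n, ∀ w ∈ filtr K x y ξ η n, ∃ m, r * w ∈ filtr K x y ξ η m := by
    intro r
    have hr : r ∈ Algebra.adjoin ℂ ({x, y, ξ, η} ∪ (K : Set R)) := hgen ▸ Algebra.mem_top
    have hmono : Monotone (filtr K x y ξ η) := monotone_nat_of_le_succ (filtr_mono_succ _ _ _ _ _)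
    induction hr using Algebra.adjoin_induction with
    | mem r hr =>
      intro n w hw
      rcases hr with hr | hr
      · exact ⟨n + 1, mul_mem_filtr _ _ _ _ _ (Submodule.subset_span hr) hw⟩
      · exact ⟨n, d.K_mul_mem hr hw⟩
    | algebraMap c =>
      intro n w hw
      exact ⟨n, by rw [← Algebra.smul_def]; exact Submodule.smul_mem _ _ hw⟩
    | add r s _ _ hr hs =>
      intro n w hw
      obtain ⟨i, hi⟩ := hr n w hw
      obtain ⟨j, hj⟩ := hs n w hw
      exact ⟨max i j, (add_mul r s w).symm ▸
        add_mem (hmono (le_max_left _ _) hi) (hmono (le_max_right _ _) hj)⟩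
    | mul r s _ _ hr hs =>
      intro n w hw
      obtain ⟨i, hi⟩ := hs n w hw
      obtain ⟨j, hj⟩ := hr i _ hi
      exact ⟨j, by rwa [mul_assoc]⟩
  obtain ⟨n, hn⟩ := hfil a 0 1 K.one_mem
  rw [mul_one] at hn
  obtain ⟨T, hT, h⟩ := d.exists_aeval_mem n a hn
  have h1 : rightComm u a = 0 := by rw [rightComm_apply, hu, sub_self]
  have h2 : rightComm v a = 0 := by rw [rightComm_apply, hv, sub_self]
  have h0 : casimirOp u v a = 0 := by simp [casimirOp, weightOp, h1, h2]
  have hTa : Polynomial.aeval (casimirOp u v) T a = T.eval 0 • a := by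
    clear h hT
    induction T using Polynomial.induction_on with
    | C c => simp [Module.algebraMap_end_apply]
    | add p q hp hq => simp [hp, hq, add_smul]
    | monomial n c ih =>
      simp [pow_succ, ← mul_assoc, map_mul _ _ Polynomial.X, Module.End.mul_apply, h0]
  rw [hTa] at h
  have := Subalgebra.smul_mem _ h (T.eval 0)⁻¹
  rwa [smul_smul, inv_mul_cancel₀ hT, one_smul] at this

end SlTwoData
end Filtration

/-! ### Isometries of the Euclidean plane and their reflections. -/

section Plane

variable {E : Type*} [NormedAddCommGroup E] [InnerProductSpace ℝ E]

theorem reflection_apply {G : Subgroup (E ≃ₗᵢ[ℝ] E)} (s : reflections G) (w : E) :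
    ((s : G) : E ≃ₗᵢ[ℝ] E) w
      = w - (2 * (inner ℝ (root s) w / inner ℝ (root s) (root s))) • root s := by
  have h : (root s) = Classical.choose s.2 := rfl
  rw [(Classical.choose_spec s.2).2, ← h, Submodule.reflection_orthogonal_apply,
    Submodule.reflection_singleton_apply, two_smul, mul_smul, two_smul, real_inner_self_eq_norm_sq]
  simp

theorem reflection_involutive {G : Subgroup (E ≃ₗᵢ[ℝ] E)} (s : reflections G) (w : E) :
    ((s : G) : E ≃ₗᵢ[ℝ] E) (((s : G) : E ≃ₗᵢ[ℝ] E) w) = w := by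
  have h : inner ℝ (root s) (root s) ≠ 0 := inner_self_ne_zero.2 (root_ne_zero s)
  conv_lhs => rw [reflection_apply s w]
  rw [map_sub, map_smul, apply_root, reflection_apply s w]
  module

theorem inner_reflection {G : Subgroup (E ≃ₗᵢ[ℝ] E)} (s : reflections G) (w z : E) :
    inner ℝ (((s : G) : E ≃ₗᵢ[ℝ] E) w) z = inner ℝ w (((s : G) : E ≃ₗᵢ[ℝ] E) z) := by
  conv_lhs => rw [← reflection_involutive s z]
  exact LinearIsometryEquiv.inner_map_map _ _ _

/-- This rewrites the coefficient in the Cherednik relation without the root, so the relation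
becomes manifestly equivariant. -/
theorem root_coeff {G : Subgroup (E ≃ₗᵢ[ℝ] E)} (s : reflections G) (w z : E) :
    2 * (inner ℝ w (root s) * inner ℝ (root s) z / inner ℝ (root s) (root s))
      = inner ℝ w (z - ((s : G) : E ≃ₗᵢ[ℝ] E) z) := by
  rw [reflection_apply, sub_sub_cancel, inner_smul_right]
  ring

/-- Conjugation of a reflection by an element of `G`. -/
def conjReflection {G : Subgroup (E ≃ₗᵢ[ℝ] E)} (g : G) (s : reflections G) : reflections G :=
  ⟨g * s * g⁻¹, by
    obtain ⟨v, hv, h⟩ := s.2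
    refine ⟨(g : E ≃ₗᵢ[ℝ] E) v, fun h0 => hv ?_, ?_⟩
    · simpa using h0
    · have h1 : (((g * s * g⁻¹ : G)) : E ≃ₗᵢ[ℝ] E) = (g : E ≃ₗᵢ[ℝ] E) * (s : G) * (g : E ≃ₗᵢ[ℝ] E)⁻¹ := rfl
      have key : ∀ (u : E) (w : E), ((Submodule.span ℝ {u})ᗮ.reflection) w
          = w - (2 * (inner ℝ u w / ‖u‖ ^ 2)) • u := by
        intro u w
        rw [Submodule.reflection_orthogonal_apply, Submodule.reflection_singleton_apply, two_smul,
          mul_smul, two_smul]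
        simp
      rw [h1, h]
      ext w
      rw [key]
      change (g : E ≃ₗᵢ[ℝ] E) ((Submodule.span ℝ {v})ᗮ.reflection ((g : E ≃ₗᵢ[ℝ] E).symm w)) = _
      rw [key, map_sub, map_smul, LinearIsometryEquiv.apply_symm_apply, LinearIsometryEquiv.norm_map]
      congr 4
      rw [← LinearIsometryEquiv.inner_map_map (g : E ≃ₗᵢ[ℝ] E),
        LinearIsometryEquiv.apply_symm_apply]⟩

/-- Conjugation by an element of `G` permutes the reflections. -/
def conjReflectionEquiv {G : Subgroup (E ≃ₗᵢ[ℝ] E)} (g : G) : reflections G ≃ reflections G where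
  toFun := conjReflection g
  invFun := conjReflection g⁻¹
  left_inv s := by ext1; simp [conjReflection, mul_assoc]
  right_inv s := by ext1; simp [conjReflection, mul_assoc]

variable (b : OrthonormalBasis (Fin 2) ℝ E)

/-- `g` is a rotation of the plane. -/
def IsRot (g : E ≃ₗᵢ[ℝ] E) : Prop :=
  ∃ p q : ℝ, p ^ 2 + q ^ 2 = 1 ∧ g (b 0) = p • b 0 + q • b 1 ∧ g (b 1) = (-q) • b 0 + p • b 1

/-- `g` is an orientation reversing isometry of the plane. -/
def IsRef (g : E ≃ₗᵢ[ℝ] E) : Prop :=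
  ∃ p q : ℝ, p ^ 2 + q ^ 2 = 1 ∧ g (b 0) = p • b 0 + q • b 1 ∧ g (b 1) = q • b 0 + (-p) • b 1

theorem basis_expansion (w : E) : inner ℝ (b 0) w • b 0 + inner ℝ (b 1) w • b 1 = w := by
  simpa using b.sum_repr' w

theorem inner_basis (i j : Fin 2) : inner ℝ (b i) (b j) = if i = j then (1 : ℝ) else 0 :=
  orthonormal_iff_ite.1 b.orthonormal i j

theorem inner_comb (p q r t : ℝ) :
    inner ℝ (p • b 0 + q • b 1) (r • b 0 + t • b 1) = p * r + q * t := by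
  simp [inner_add_left, inner_add_right, inner_smul_left, inner_smul_right, mul_comm]

theorem isRot_or_isRef (g : E ≃ₗᵢ[ℝ] E) : IsRot b g ∨ IsRef b g := by
  obtain ⟨p, q, h0⟩ : ∃ p q : ℝ, g (b 0) = p • b 0 + q • b 1 :=
    ⟨_, _, (basis_expansion b _).symm⟩
  obtain ⟨r, t, h1⟩ : ∃ r t : ℝ, g (b 1) = r • b 0 + t • b 1 :=
    ⟨_, _, (basis_expansion b _).symm⟩
  have e0 : p * p + q * q = 1 := by
    rw [← inner_comb b, ← h0, g.inner_map_map]; simp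
  have e1 : r * r + t * t = 1 := by
    rw [← inner_comb b, ← h1, g.inner_map_map]; simp
  have e2 : p * r + q * t = 0 := by
    rw [← inner_comb b, ← h0, ← h1, g.inner_map_map]; simp
  -- The determinant squares to 1 by Lagrange's identity (pt - qr)² = (p² + q²)(r² + t²) - (pr +
  -- qt)².
  have hd : (p * t - q * r - 1) * (p * t - q * r + 1) = 0 := by
    linear_combination (e0 * (r * r + t * t)) + e1 - e2 * (p * r + q * t)
  rcases mul_eq_zero.1 hd with h | h
  · left
    have ht : t = p := by linear_combination p * h + (-t) * e0 + q * e2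
    have hr : r = -q := by linear_combination (-q) * h + (-r) * e0 + p * e2
    exact ⟨p, q, by linarith [e0], h0, by rw [h1, hr, ht]⟩
  · right
    have ht : t = -p := by linear_combination p * h + (-t) * e0 + q * e2
    have hr : r = q := by linear_combination (-q) * h + (-r) * e0 + p * e2
    exact ⟨p, q, by linarith [e0], h0, by rw [h1, hr, ht]⟩

theorem det_of_coords (g : E →ₗ[ℝ] E) {p q r t : ℝ} (h0 : g (b 0) = p • b 0 + q • b 1)
    (h1 : g (b 1) = r • b 0 + t • b 1) : LinearMap.det g = p * t - r * q := by
  rw [← LinearMap.det_toMatrix b.toBasis, Matrix.det_fin_two]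
  simp [LinearMap.toMatrix_apply, h0, h1]

theorem IsRot.det {g : E ≃ₗᵢ[ℝ] E} (h : IsRot b g) :
    LinearMap.det (g.toLinearEquiv : E →ₗ[ℝ] E) = 1 := by
  obtain ⟨p, q, h, h0, h1⟩ := h
  rw [det_of_coords b _ h0 h1]
  linear_combination h

theorem IsRef.det {g : E ≃ₗᵢ[ℝ] E} (h : IsRef b g) :
    LinearMap.det (g.toLinearEquiv : E →ₗ[ℝ] E) = -1 := by
  obtain ⟨p, q, h, h0, h1⟩ := h
  rw [det_of_coords b _ h0 h1]
  linear_combination -h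

theorem isRot_iff_det (g : E ≃ₗᵢ[ℝ] E) :
    IsRot b g ↔ LinearMap.det (g.toLinearEquiv : E →ₗ[ℝ] E) = 1 := by
  refine ⟨fun h => h.det, fun h => (isRot_or_isRef b g).resolve_right fun h' => ?_⟩
  rw [h'.det] at h
  norm_num at h

theorem isRef_iff_not_isRot (g : E ≃ₗᵢ[ℝ] E) : IsRef b g ↔ ¬ IsRot b g := by
  refine ⟨fun h h' => ?_, fun h => (isRot_or_isRef b g).resolve_left h⟩
  have := h.det.symm.trans h'.det
  norm_num at this

theorem isRef_reflection {G : Subgroup (E ≃ₗᵢ[ℝ] E)} (s : reflections G) :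
    IsRef b ((s : G) : E ≃ₗᵢ[ℝ] E) := by
  obtain ⟨m, n, h⟩ : ∃ m n : ℝ, root s = m • b 0 + n • b 1 :=
    ⟨_, _, (basis_expansion b _).symm⟩
  have hN : m ^ 2 + n ^ 2 ≠ 0 := by
    rw [sq, sq, ← inner_comb b, ← h]
    exact inner_self_ne_zero.2 (root_ne_zero s)
  have e0 : inner ℝ (m • b 0 + n • b 1) (b 0) = m := by
    have := inner_comb b m n 1 0
    simpa using this
  have e1 : inner ℝ (m • b 0 + n • b 1) (b 1) = n := by
    have := inner_comb b m n 0 1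
    simpa using this
  refine ⟨1 - 2 * m ^ 2 / (m ^ 2 + n ^ 2), -(2 * m * n / (m ^ 2 + n ^ 2)), ?_, ?_, ?_⟩
  · field_simp; ring
  · rw [reflection_apply, h, inner_comb, e0, ← sq, ← sq]
    match_scalars <;> field_simp
  · rw [reflection_apply, h, inner_comb, e1, ← sq, ← sq]
    match_scalars <;> field_simp
    ring

end Plane

/-! ### Consequences of the Cherednik relations in an arbitrary algebra. -/

section Relations

variable {E : Type*} [NormedAddCommGroup E] [InnerProductSpace ℝ E]
variable {G : Subgroup (E ≃ₗᵢ[ℝ] E)} [Fintype (reflections G)]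
variable {R : Type*} [Ring R] [Algebra ℂ R]

/-- The relations of the rational Cherednik algebra, for maps `d` from vectors, `f` from vectors
regarded as covectors and `γ` from `G` to an algebra. -/
structure CherednikRel (c : reflections G → ℂ) (f d : E → R) (γ : G →* R) : Prop where
  f_add : ∀ w z, f (w + z) = f w + f z
  f_smul : ∀ (r : ℝ) w, f (r • w) = (r : ℂ) • f w
  d_add : ∀ w z, d (w + z) = d w + d z
  d_smul : ∀ (r : ℝ) w, d (r • w) = (r : ℂ) • d w
  f_mul_f : ∀ w z, f w * f z = f z * f w
  d_mul_d : ∀ w z, d w * d z = d z * d w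
  γ_mul_f : ∀ (g : G) w, γ g * f w = f ((g : E ≃ₗᵢ[ℝ] E) w) * γ g
  γ_mul_d : ∀ (g : G) w, γ g * d w = d ((g : E ≃ₗᵢ[ℝ] E) w) * γ g
  d_comm_f : ∀ w z, d w * f z - f z * d w = ((inner ℝ z w : ℝ) : ℂ) • (1 : R)
    - ∑ s : reflections G, (((inner ℝ z (w - ((s : G) : E ≃ₗᵢ[ℝ] E) w) : ℝ) : ℂ) * c s) •
      γ (s : G)

/-- The element `σ`. -/
def relSigma (c : reflections G → ℂ) (γ : G →* R) : R := ∑ s : reflections G, c s • γ (s : G)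

/-- The element `E₊`. -/
def relEplus (b : OrthonormalBasis (Fin 2) ℝ E) (f : E → R) : R :=
  (1 / 2 : ℂ) • (f (b 0) ^ 2 + f (b 1) ^ 2)

/-- The element `E₋`. -/
def relEminus (b : OrthonormalBasis (Fin 2) ℝ E) (d : E → R) : R :=
  -((1 / 2 : ℂ) • (d (b 0) ^ 2 + d (b 1) ^ 2))

/-- The element `H`. -/
def relH (b : OrthonormalBasis (Fin 2) ℝ E) (c : reflections G → ℂ) (f d : E → R) (γ : G →* R) :
    R :=
  f (b 0) * d (b 0) + f (b 1) * d (b 1) + 1 - relSigma c γ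

/-- The element `Z₀`. -/
def relZ (b : OrthonormalBasis (Fin 2) ℝ E) (f d : E → R) : R :=
  Complex.I • (f (b 0) * d (b 1) - f (b 1) * d (b 0))

namespace CherednikRel

variable {c : reflections G → ℂ} {f d : E → R} {γ : G →* R} (h : CherednikRel c f d γ)
include h

/-- Exchanging vectors and covectors. -/
theorem swap : CherednikRel c d (fun w => -f w) γ where
  f_add := h.d_add
  f_smul := h.d_smul
  d_add w z := by simp only [h.f_add, neg_add]
  d_smul r w := by simp only [h.f_smul, smul_neg]
  f_mul_f := h.d_mul_d
  d_mul_d w z := by simp only [neg_mul_neg, h.f_mul_f w z]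
  γ_mul_f := h.γ_mul_d
  γ_mul_d g w := by simp only [mul_neg, neg_mul, h.γ_mul_f]
  d_comm_f w z := by
    -- A reflection is self-adjoint, so the coefficient is symmetric in the two vectors. This makes
    -- the Fourier exchange of d with -f legitimate.
    have hsym : ∀ s : reflections G, inner ℝ z (w - ((s : G) : E ≃ₗᵢ[ℝ] E) w)
        = inner ℝ w (z - ((s : G) : E ≃ₗᵢ[ℝ] E) z) := by
      intro s
      rw [inner_sub_right, inner_sub_right, ← inner_reflection s z w, real_inner_comm w z,
        real_inner_comm w]
    have := h.d_comm_f z w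
    simp only [hsym]
    rw [← real_inner_comm z w, ← this]
    simp only [neg_mul, mul_neg]
    abel

theorem sum_inner_f (b : OrthonormalBasis (Fin 2) ℝ E) (w : E) :
    ((inner ℝ (b 0) w : ℝ) : ℂ) • f (b 0) + ((inner ℝ (b 1) w : ℝ) : ℂ) • f (b 1) = f w := by
  rw [← h.f_smul, ← h.f_smul, ← h.f_add, basis_expansion]

omit h in
theorem γ_mul_sigma (hc : ∀ s t : reflections G, IsConj (s : G) (t : G) → c s = c t) (g : G) :
    γ g * relSigma c γ = relSigma c γ * γ g := by
  rw [relSigma, Finset.mul_sum, Finset.sum_mul]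
  refine Fintype.sum_equiv (conjReflectionEquiv g) _ _ fun s => ?_
  have h1 : c s = c (conjReflectionEquiv g s) := hc _ _ (isConj_iff.2 ⟨g, rfl⟩)
  have h2 : ((conjReflectionEquiv g s : reflections G) : G) = g * s * g⁻¹ := rfl
  rw [h1, h2, mul_smul_comm, smul_mul_assoc, ← map_mul, ← map_mul, inv_mul_cancel_right]

variable (b : OrthonormalBasis (Fin 2) ℝ E)

/-- The reflection terms cancel. Summing ⟪bᵢ, w - sw⟫(bᵢ + s bᵢ) over the basis gives (w - sw) + s(w
- sw), which is 0 since w - sw is a -1 eigenvector of s. What remains is the commutator of the Weyl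
algebra. -/
theorem rightComm_Eplus_d (w : E) : rightComm (relEplus b f) (d w) = f w := by
  have key : ∀ z, d w * f z ^ 2 - f z ^ 2 * d w
      = (2 * ((inner ℝ z w : ℝ) : ℂ)) • f z
        - ∑ s : reflections G, (((inner ℝ z (w - ((s : G) : E ≃ₗᵢ[ℝ] E) w) : ℝ) : ℂ) * c s) •
          ((f z + f (((s : G) : E ≃ₗᵢ[ℝ] E) z)) * γ (s : G)) := by
    intro z
    have h1 : d w * f z ^ 2 - f z ^ 2 * d w
        = (d w * f z - f z * d w) * f z + f z * (d w * f z - f z * d w) := by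
      simp only [sq, sub_mul, mul_sub, mul_assoc]; abel
    rw [h1, h.d_comm_f]
    simp only [sub_mul, mul_sub, Finset.sum_mul, Finset.mul_sum, smul_mul_assoc, mul_smul_comm,
      one_mul, mul_one, h.γ_mul_f, add_mul, smul_add, Finset.sum_add_distrib]
    module
  have hs : ∀ s : reflections G,
      ((inner ℝ (b 0) (w - ((s : G) : E ≃ₗᵢ[ℝ] E) w) : ℝ) : ℂ) •
          f (((s : G) : E ≃ₗᵢ[ℝ] E) (b 0))
        + ((inner ℝ (b 1) (w - ((s : G) : E ≃ₗᵢ[ℝ] E) w) : ℝ) : ℂ) •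
          f (((s : G) : E ≃ₗᵢ[ℝ] E) (b 1))
        = -f (w - ((s : G) : E ≃ₗᵢ[ℝ] E) w) := by
    intro s
    have hneg : ∀ z, f (-z) = -f z := fun z => by
      rw [← neg_one_smul ℝ, h.f_smul]; simp
    rw [← hneg, neg_sub, ← h.f_smul, ← h.f_smul, ← h.f_add,
      ← map_smul ((s : G) : E ≃ₗᵢ[ℝ] E) _ (b 0), ← map_smul ((s : G) : E ≃ₗᵢ[ℝ] E) _ (b 1),
      ← map_add ((s : G) : E ≃ₗᵢ[ℝ] E), basis_expansion, map_sub, reflection_involutive]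
  have hlin : ∀ (k l m : ℂ) (A B A' B' g X : R), k • A + l • B = X → k • A' + l • B' = -X →
      (k * m) • ((A + A') * g) + (l * m) • ((B + B') * g) = 0 := by
    intro k l m A B A' B' g X h1 h2
    have : (k * m) • ((A + A') * g) + (l * m) • ((B + B') * g)
        = m • ((k • A + l • B + (k • A' + l • B')) * g) := by
      simp only [add_mul, smul_mul_assoc]; module
    rw [this, h1, h2]; simp
  rw [rightComm_apply, relEplus, mul_smul_comm, smul_mul_assoc, ← smul_sub, mul_add,
    add_mul, add_sub_add_comm, key, key, sub_add_sub_comm, ← Finset.sum_add_distrib,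
    Finset.sum_eq_zero fun s _ => hlin _ _ _ _ _ _ _ _ _ (h.sum_inner_f b _) (hs s),
    ← h.sum_inner_f b w]
  module

theorem rightComm_Eminus_f (w : E) : rightComm (relEminus b d) (f w) = d w := by
  rw [← h.swap.rightComm_Eplus_d b w]
  simp only [rightComm_apply, relEminus, relEplus, mul_neg, neg_mul]

theorem rightComm_Eplus_f (w : E) : rightComm (relEplus b f) (f w) = 0 := by
  have h1 : ∀ z, f w * f z ^ 2 = f z ^ 2 * f w := fun z =>
    (Commute.pow_right (h.f_mul_f w z) 2)
  rw [rightComm_apply, relEplus, mul_smul_comm, smul_mul_assoc, mul_add, add_mul,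
    h1, h1, sub_self]

theorem rightComm_Eminus_d (w : E) : rightComm (relEminus b d) (d w) = 0 := by
  have := h.swap.rightComm_Eplus_f b w
  rw [rightComm_apply] at this ⊢
  rw [relEminus, mul_neg, neg_mul, ← neg_sub']
  exact neg_eq_zero.2 this

theorem γ_mul_Eplus (g : G) : γ g * relEplus b f = relEplus b f * γ g := by
  have h1 : ∀ w, γ g * f w ^ 2 = f ((g : E ≃ₗᵢ[ℝ] E) w) ^ 2 * γ g := fun w => by
    rw [sq, sq, ← mul_assoc, h.γ_mul_f, mul_assoc, h.γ_mul_f, mul_assoc]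
  rw [relEplus, mul_smul_comm, smul_mul_assoc, mul_add, h1, h1, ← add_mul]
  congr 2
  have key : ∀ p q : ℝ, p ^ 2 + q ^ 2 = 1 → (p : ℂ) ^ 2 + (q : ℂ) ^ 2 = 1 := fun p q hpq => by
    exact_mod_cast congrArg (fun r : ℝ => (r : ℂ)) hpq
  rcases isRot_or_isRef b g with ⟨p, q, hpq, h0, h1⟩ | ⟨p, q, hpq, h0, h1⟩ <;>
  · rw [h0, h1]
    simp only [h.f_add, h.f_smul, sq, mul_add, add_mul, smul_mul_assoc, mul_smul_comm,
      h.f_mul_f (b 1) (b 0), Complex.ofReal_neg]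
    match_scalars
    · linear_combination key p q hpq
    · ring
    · linear_combination key p q hpq

theorem γ_mul_Eminus (g : G) : γ g * relEminus b d = relEminus b d * γ g := by
  rw [relEminus, mul_neg, neg_mul]
  exact congrArg _ (h.swap.γ_mul_Eplus b g)

theorem γ_mul_Z_aux (g : G) : γ g * relZ b f d
    = Complex.I • (f ((g : E ≃ₗᵢ[ℝ] E) (b 0)) * d ((g : E ≃ₗᵢ[ℝ] E) (b 1))
      - f ((g : E ≃ₗᵢ[ℝ] E) (b 1)) * d ((g : E ≃ₗᵢ[ℝ] E) (b 0))) * γ g := by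
  have h1 : ∀ w z, γ g * (f w * d z)
      = f ((g : E ≃ₗᵢ[ℝ] E) w) * d ((g : E ≃ₗᵢ[ℝ] E) z) * γ g := fun w z => by
    rw [← mul_assoc, h.γ_mul_f, mul_assoc, h.γ_mul_d, mul_assoc]
  rw [relZ, mul_smul_comm, mul_sub, h1, h1, ← sub_mul, smul_mul_assoc]

theorem γ_mul_Z_of_isRot {g : G} (hg : IsRot b (g : E ≃ₗᵢ[ℝ] E)) :
    γ g * relZ b f d = relZ b f d * γ g := by
  obtain ⟨p, q, hpq, h0, h1⟩ := hg
  have key : (p : ℂ) ^ 2 + (q : ℂ) ^ 2 = 1 := by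
    exact_mod_cast congrArg (fun r : ℝ => (r : ℂ)) hpq
  rw [h.γ_mul_Z_aux, relZ, h0, h1]
  congr 2
  simp only [h.f_add, h.f_smul, h.d_add, h.d_smul, mul_add, add_mul, smul_mul_assoc,
    mul_smul_comm, Complex.ofReal_neg]
  match_scalars
  · ring
  · linear_combination -key
  · linear_combination key
  · ring

/-- Z₀ is built from the area form, so an isometry multiplies it by its determinant under
conjugation. -/
theorem γ_mul_Z_of_isRef {g : G} (hg : IsRef b (g : E ≃ₗᵢ[ℝ] E)) :
    γ g * relZ b f d = -(relZ b f d * γ g) := by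
  obtain ⟨p, q, hpq, h0, h1⟩ := hg
  have key : (p : ℂ) ^ 2 + (q : ℂ) ^ 2 = 1 := by
    exact_mod_cast congrArg (fun r : ℝ => (r : ℂ)) hpq
  rw [h.γ_mul_Z_aux, relZ, h0, h1, ← neg_mul, ← smul_neg]
  congr 2
  simp only [h.f_add, h.f_smul, h.d_add, h.d_smul, mul_add, add_mul, smul_mul_assoc,
    mul_smul_comm, Complex.ofReal_neg]
  match_scalars
  · ring
  · linear_combination key
  · linear_combination -key
  · ring

theorem sigma_mul_Z : relSigma c γ * relZ b f d = -(relZ b f d * relSigma c γ) := by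
  rw [relSigma, Finset.sum_mul, Finset.mul_sum, ← Finset.sum_neg_distrib]
  refine Finset.sum_congr rfl fun s _ => ?_
  rw [smul_mul_assoc, h.γ_mul_Z_of_isRef b (isRef_reflection b s), smul_neg, mul_smul_comm]

/-- The term 1 - σ comes from reordering ∑ d f. The commutators sum to 2 minus ∑ c(s) tr(1 - s) s,
and tr(1 - s) = 2 in the plane. -/
theorem relH_eq : relH b c f d γ
    = relEplus b f * relEminus b d - relEminus b d * relEplus b f := by
  have h1 : relEplus b f * relEminus b d - relEminus b d * relEplus b f
      = (1 / 2 : ℂ) • (rightComm (relEplus b f) (d (b 0)) * d (b 0)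
        + d (b 0) * rightComm (relEplus b f) (d (b 0))
        + (rightComm (relEplus b f) (d (b 1)) * d (b 1)
        + d (b 1) * rightComm (relEplus b f) (d (b 1)))) := by
    rw [← rightComm_mul, ← rightComm_mul, ← map_add, ← map_smul, rightComm_apply, relEminus, sq, sq]
    simp only [mul_neg, neg_mul]
    abel
  have h2 : d (b 0) * f (b 0) - f (b 0) * d (b 0) + (d (b 1) * f (b 1) - f (b 1) * d (b 1))
      = (2 : ℂ) • (1 - relSigma c γ) := by
    rw [h.d_comm_f, h.d_comm_f, sub_add_sub_comm, ← Finset.sum_add_distrib, smul_sub,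
      relSigma, Finset.smul_sum, inner_basis, inner_basis]
    congr 1
    · simp only [if_true]; push_cast; module
    · refine Finset.sum_congr rfl fun s _ => ?_
      obtain ⟨p, q, -, h0, h1⟩ := isRef_reflection b s
      rw [h0, h1]
      simp only [inner_sub_right, inner_add_right, inner_smul_right, inner_basis]
      norm_num
      module
  have h3 : d (b 0) * f (b 0) + d (b 1) * f (b 1)
      = f (b 0) * d (b 0) + f (b 1) * d (b 1) + (2 : ℂ) • (1 - relSigma c γ) := by
    rw [← h2]; abel
  have h4 : f (b 0) * d (b 0) + d (b 0) * f (b 0) + (f (b 1) * d (b 1) + d (b 1) * f (b 1))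
      = f (b 0) * d (b 0) + f (b 1) * d (b 1)
        + (d (b 0) * f (b 0) + d (b 1) * f (b 1)) := by abel
  rw [h1, h.rightComm_Eplus_d, h.rightComm_Eplus_d, h4, h3, relH]
  module

end CherednikRel
end Relations

/-! ### The polynomial representation by Dunkl operators, in isotropic coordinates. -/

section PolynomialRepresentation

open MvPolynomial

variable {E : Type*} [NormedAddCommGroup E] [InnerProductSpace ℝ E]
variable (b : OrthonormalBasis (Fin 2) ℝ E)

/-- The complex coordinate of a vector. -/
def zc : E →ₗ[ℝ] ℂ where
  toFun w := ((inner ℝ (b 0) w : ℝ) : ℂ) + ((inner ℝ (b 1) w : ℝ) : ℂ) * Complex.I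
  map_add' w z := by simp only [inner_add_right]; push_cast; ring
  map_smul' r w := by simp only [inner_smul_right]; push_cast; simp; ring

theorem zc_apply (w : E) :
    zc b w = ((inner ℝ (b 0) w : ℝ) : ℂ) + ((inner ℝ (b 1) w : ℝ) : ℂ) * Complex.I := rfl

@[simp] theorem zc_zero : zc b (b 0) = 1 := by simp [zc_apply]
@[simp] theorem zc_one : zc b (b 1) = Complex.I := by simp [zc_apply]

theorem zc_ne_zero {w : E} (hw : w ≠ 0) : zc b w ≠ 0 := by
  intro h
  apply hw
  have h1 := congrArg Complex.re h
  have h2 := congrArg Complex.im h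
  simp [zc_apply] at h1 h2
  rw [← basis_expansion b w, h1, h2]
  simp

theorem inner_eq_zc (w z : E) : ((inner ℝ w z : ℝ) : ℂ)
    = (1 / 2) * (star (zc b w) * zc b z + zc b w * star (zc b z)) := by
  conv_lhs => rw [← basis_expansion b w, ← basis_expansion b z]
  rw [inner_comb]
  simp only [zc_apply, star_add, star_mul', Complex.star_def, Complex.conj_ofReal, Complex.conj_I]
  push_cast
  linear_combination (((inner ℝ (b 1) w : ℝ) : ℂ) * ((inner ℝ (b 1) z : ℝ) : ℂ)) * Complex.I_sq

/-- The linear form `⟪w, ·⟫` in the complex coordinates `X 0` and `X 1`. -/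
def lin (w : E) : MvPolynomial (Fin 2) ℂ :=
  C (1 / 2 * star (zc b w)) * X 0 + C (1 / 2 * zc b w) * X 1

theorem lin_add (w z : E) : lin b (w + z) = lin b w + lin b z := by
  simp only [lin, map_add, star_add, mul_add, add_mul]; ring

theorem lin_smul (r : ℝ) (w : E) : lin b (r • w) = C (r : ℂ) * lin b w := by
  simp only [lin, map_smul, Complex.real_smul, star_mul', Complex.star_def, Complex.conj_ofReal,
    C_mul]
  ring

theorem lin_sub (w z : E) : lin b (w - z) = lin b w - lin b z := by
  rw [eq_sub_iff_add_eq, ← lin_add, sub_add_cancel]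

theorem lin_ne_zero {w : E} (hw : w ≠ 0) : lin b w ≠ 0 := by
  intro h
  have h1 := congrArg (eval ![0, 1]) h
  simp [lin] at h1
  exact zc_ne_zero b hw h1

theorem C_I_mul : (C Complex.I * C Complex.I : MvPolynomial (Fin 2) ℂ) = -1 := by
  rw [← C_mul, Complex.I_mul_I]; simp

theorem C_half : (C (1 / 2) + C (1 / 2) : MvPolynomial (Fin 2) ℂ) = 1 := by
  rw [← C_add]; norm_num

theorem lin_zero_eq : lin b (b 0) = C (1 / 2) * X 0 + C (1 / 2) * X 1 := by
  simp [lin]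

theorem lin_one_eq : lin b (b 1) = C Complex.I * C (1 / 2) * (X 1 - X 0) := by
  simp only [lin, zc_one, Complex.star_def, Complex.conj_I, C_mul, C_neg]
  ring

theorem X_zero_eq : (X 0 : MvPolynomial (Fin 2) ℂ) = lin b (b 0) + C Complex.I * lin b (b 1) := by
  rw [lin_zero_eq, lin_one_eq]
  linear_combination (-C (1 / 2) * (X 1 - X 0)) * C_I_mul - X 0 * C_half

theorem X_one_eq : (X 1 : MvPolynomial (Fin 2) ℂ) = lin b (b 0) - C Complex.I * lin b (b 1) := by
  rw [lin_zero_eq, lin_one_eq]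
  linear_combination (C (1 / 2) * (X 1 - X 0)) * C_I_mul - X 1 * C_half

theorem submodule_eq_top_of_lin {S : Submodule ℂ (MvPolynomial (Fin 2) ℂ)} (h1 : 1 ∈ S)
    (hmul : ∀ z p, p ∈ S → lin b z * p ∈ S) (p : MvPolynomial (Fin 2) ℂ) : p ∈ S := by
  induction p using MvPolynomial.induction_on with
  | C a =>
    rw [C_eq_smul_one]; exact S.smul_mem _ h1
  | add p q hp hq => exact S.add_mem hp hq
  | mul_X p i hp =>
    have h0 := hmul (b 0) p hp
    have h1 := S.smul_mem Complex.I (hmul (b 1) p hp)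
    fin_cases i
    · have : p * X 0 = lin b (b 0) * p + Complex.I • (lin b (b 1) * p) := by
        rw [X_zero_eq b, smul_eq_C_mul]; ring
      exact this ▸ S.add_mem h0 h1
    · have : p * X 1 = lin b (b 0) * p - Complex.I • (lin b (b 1) * p) := by
        rw [X_one_eq b, smul_eq_C_mul]; ring
      exact this ▸ S.sub_mem h0 h1

/-- Linear forms generate the polynomials from 1, so an operator identity can be proved by comparing
commutators with linear forms. All the relations that are not visible at once, including
commutativity of Dunkl operators, are obtained in this way. -/
theorem linearMap_ext_of_lin {K L : Module.End ℂ (MvPolynomial (Fin 2) ℂ)} (h1 : K 1 = L 1)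
    (hmul : ∀ z p, K p = L p → K (lin b z * p) = L (lin b z * p)) : K = L := by
  refine LinearMap.ext fun p => ?_
  exact submodule_eq_top_of_lin b (S := LinearMap.eqLocus K L) h1 hmul p

/-- The action of an isometry on polynomials. -/
def act (g : E ≃ₗᵢ[ℝ] E) : MvPolynomial (Fin 2) ℂ →ₐ[ℂ] MvPolynomial (Fin 2) ℂ :=
  aeval ![lin b (g (b 0)) + C Complex.I * lin b (g (b 1)),
    lin b (g (b 0)) - C Complex.I * lin b (g (b 1))]

theorem act_C (g : E ≃ₗᵢ[ℝ] E) (a : ℂ) : act b g (C a) = C a := (act b g).commutes a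

theorem act_lin (g : E ≃ₗᵢ[ℝ] E) (w : E) : act b g (lin b w) = lin b (g w) := by
  have h0 : act b g (X 0) = lin b (g (b 0)) + C Complex.I * lin b (g (b 1)) := by simp [act]
  have h1 : act b g (X 1) = lin b (g (b 0)) - C Complex.I * lin b (g (b 1)) := by simp [act]
  have e0 : act b g (lin b (b 0)) = lin b (g (b 0)) := by
    rw [lin_zero_eq, map_add, map_mul, map_mul, act_C, h0, h1]
    linear_combination lin b (g (b 0)) * C_half
  have e1 : act b g (lin b (b 1)) = lin b (g (b 1)) := by
    rw [lin_one_eq, map_mul, map_mul, map_sub, act_C, act_C, h0, h1]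
    linear_combination (-2 * C (1 / 2) * lin b (g (b 1))) * C_I_mul + lin b (g (b 1)) * C_half
  rw [← basis_expansion b w]
  simp only [map_add, map_smul, lin_add, lin_smul, map_mul, act_C, e0, e1]

theorem act_mul (g k : E ≃ₗᵢ[ℝ] E) (p : MvPolynomial (Fin 2) ℂ) :
    act b (g * k) p = act b g (act b k p) := by
  have : (act b (g * k)).toLinearMap = (act b g).toLinearMap ∘ₗ (act b k).toLinearMap := by
    refine linearMap_ext_of_lin b (by simp) fun z p hp => ?_
    simp only [AlgHom.toLinearMap_apply, LinearMap.comp_apply, map_mul, act_lin] at hp ⊢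
    rw [hp]; rfl
  exact LinearMap.congr_fun this p

theorem act_one (p : MvPolynomial (Fin 2) ℂ) : act b 1 p = p := by
  have : (act b (1 : E ≃ₗᵢ[ℝ] E)).toLinearMap = LinearMap.id := by
    refine linearMap_ext_of_lin b (by simp) fun z p hp => ?_
    simp only [AlgHom.toLinearMap_apply, LinearMap.id_apply, map_mul, act_lin] at hp ⊢
    rw [hp]; rfl
  exact LinearMap.congr_fun this p

variable {G : Subgroup (E ≃ₗᵢ[ℝ] E)}

/-- The action of `G` on polynomials. -/
def actHom : G →* Module.End ℂ (MvPolynomial (Fin 2) ℂ) where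
  toFun g := (act b (g : E ≃ₗᵢ[ℝ] E)).toLinearMap
  map_one' := by
    refine LinearMap.ext fun p => ?_
    exact act_one b p
  map_mul' g k := by
    refine LinearMap.ext fun p => ?_
    exact act_mul b g k p

theorem actHom_apply (g : G) (p : MvPolynomial (Fin 2) ℂ) :
    actHom b g p = act b (g : E ≃ₗᵢ[ℝ] E) p := rfl

theorem lin_sub_reflection (s : reflections G) (w : E) :
    lin b w - lin b (((s : G) : E ≃ₗᵢ[ℝ] E) w)
      = C ((2 * (inner ℝ (root s) w / inner ℝ (root s) (root s)) : ℝ) : ℂ) * lin b (root s) := by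
  rw [← lin_sub, reflection_apply, sub_sub_cancel, lin_smul]

/-- The map p ↦ p - sp is a twisted derivation whose values on linear forms are multiples of the
root. -/
theorem lin_root_dvd (s : reflections G) (p : MvPolynomial (Fin 2) ℂ) :
    lin b (root s) ∣ p - act b ((s : G) : E ≃ₗᵢ[ℝ] E) p := by
  let S : Submodule ℂ (MvPolynomial (Fin 2) ℂ) :=
    ((Ideal.span {lin b (root s)}).restrictScalars ℂ).comap
      (LinearMap.id - (act b ((s : G) : E ≃ₗᵢ[ℝ] E)).toLinearMap)
  have hS : ∀ p, p ∈ S ↔ lin b (root s) ∣ p - act b ((s : G) : E ≃ₗᵢ[ℝ] E) p := fun p => by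
    simp [S, Ideal.mem_span_singleton]
  refine (hS p).1 (submodule_eq_top_of_lin b ((hS 1).2 (by simp)) (fun z p hp => ?_) p)
  rw [hS] at hp ⊢
  have : lin b z * p - act b ((s : G) : E ≃ₗᵢ[ℝ] E) (lin b z * p)
      = lin b z * (p - act b ((s : G) : E ≃ₗᵢ[ℝ] E) p)
      + (lin b z - lin b (((s : G) : E ≃ₗᵢ[ℝ] E) z)) * act b ((s : G) : E ≃ₗᵢ[ℝ] E) p := by
    rw [map_mul, act_lin]; ring
  rw [this, lin_sub_reflection]
  exact dvd_add (hp.mul_left _) ((dvd_mul_left _ _).mul_right _)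

/-- The divided difference `(p - s p) / α_s`. -/
def divDiff (s : reflections G) : Module.End ℂ (MvPolynomial (Fin 2) ℂ) where
  toFun p := Classical.choose (lin_root_dvd b s p)
  map_add' p q := by
    apply mul_left_cancel₀ (lin_ne_zero b (root_ne_zero s))
    rw [mul_add, ← Classical.choose_spec (lin_root_dvd b s (p + q)),
      ← Classical.choose_spec (lin_root_dvd b s p),
      ← Classical.choose_spec (lin_root_dvd b s q), map_add]
    ring
  map_smul' r p := by
    apply mul_left_cancel₀ (lin_ne_zero b (root_ne_zero s))
    rw [mul_smul_comm, RingHom.id_apply, ← Classical.choose_spec (lin_root_dvd b s (r • p)),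
      ← Classical.choose_spec (lin_root_dvd b s p), map_smul, smul_sub]

theorem lin_mul_divDiff (s : reflections G) (p : MvPolynomial (Fin 2) ℂ) :
    lin b (root s) * divDiff b s p = p - act b ((s : G) : E ≃ₗᵢ[ℝ] E) p :=
  (Classical.choose_spec (lin_root_dvd b s p)).symm

theorem divDiff_lin_mul (s : reflections G) (z : E) (p : MvPolynomial (Fin 2) ℂ) :
    divDiff b s (lin b z * p) = lin b z * divDiff b s p
      + C ((2 * (inner ℝ (root s) z / inner ℝ (root s) (root s)) : ℝ) : ℂ) *
        act b ((s : G) : E ≃ₗᵢ[ℝ] E) p := by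
  apply mul_left_cancel₀ (lin_ne_zero b (root_ne_zero s))
  rw [lin_mul_divDiff, map_mul, act_lin]
  linear_combination (act b ((s : G) : E ≃ₗᵢ[ℝ] E) p) * lin_sub_reflection b s z
    - lin b z * lin_mul_divDiff b s p

theorem divDiff_one (s : reflections G) : divDiff b s 1 = 0 := by
  apply mul_left_cancel₀ (lin_ne_zero b (root_ne_zero s))
  rw [lin_mul_divDiff, map_one, sub_self, mul_zero]

/-- The directional derivative. -/
def dirDeriv (w : E) : Derivation ℂ (MvPolynomial (Fin 2) ℂ) (MvPolynomial (Fin 2) ℂ) :=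
  mkDerivation ℂ ![C (zc b w), C (star (zc b w))]

theorem dirDeriv_lin (w z : E) : dirDeriv b w (lin b z) = C ((inner ℝ z w : ℝ) : ℂ) := by
  have h0 : dirDeriv b w (X 0) = C (zc b w) := by simp [dirDeriv, mkDerivation_X]
  have h1 : dirDeriv b w (X 1) = C (star (zc b w)) := by simp [dirDeriv, mkDerivation_X]
  rw [inner_eq_zc b, lin, map_add, Derivation.leibniz, Derivation.leibniz, h0, h1]
  have hC : ∀ a : ℂ, dirDeriv b w (C a) = 0 := fun a => (dirDeriv b w).map_algebraMap a
  simp only [hC, smul_eq_mul, mul_zero, add_zero, ← C_mul, ← C_add]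
  congr 1; ring

theorem dirDeriv_ext {K L : Derivation ℂ (MvPolynomial (Fin 2) ℂ) (MvPolynomial (Fin 2) ℂ)}
    (h0 : K (X 0) = L (X 0)) (h1 : K (X 1) = L (X 1)) : K = L := by
  refine MvPolynomial.derivation_ext fun i => ?_
  fin_cases i
  exacts [h0, h1]

variable [Fintype (reflections G)] (c : reflections G → ℂ)

/-- The Dunkl operator in the direction of a vector. -/
def dunkl (w : E) : Module.End ℂ (MvPolynomial (Fin 2) ℂ) :=
  (dirDeriv b w : MvPolynomial (Fin 2) ℂ →ₗ[ℂ] MvPolynomial (Fin 2) ℂ)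
    - ∑ s : reflections G, (c s * ((inner ℝ (root s) w : ℝ) : ℂ)) • divDiff b s

theorem dunkl_apply (w : E) (p : MvPolynomial (Fin 2) ℂ) : dunkl b c w p
    = dirDeriv b w p - ∑ s : reflections G, (c s * ((inner ℝ (root s) w : ℝ) : ℂ)) •
      divDiff b s p := by
  simp [dunkl, LinearMap.sum_apply]

theorem dunkl_one (w : E) : dunkl b c w 1 = 0 := by
  rw [dunkl_apply, Derivation.map_one_eq_zero]
  simp [divDiff_one]

theorem dunkl_add (w z : E) : dunkl b c (w + z) = dunkl b c w + dunkl b c z := by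
  have : dirDeriv b (w + z) = dirDeriv b w + dirDeriv b z :=
    dirDeriv_ext (by simp [dirDeriv, mkDerivation_X]) (by simp [dirDeriv, mkDerivation_X])
  simp only [dunkl, this, inner_add_right, Complex.ofReal_add, mul_add, add_smul,
    Finset.sum_add_distrib, Derivation.coe_add_linearMap]
  abel

theorem dunkl_smul (r : ℝ) (w : E) : dunkl b c (r • w) = (r : ℂ) • dunkl b c w := by
  have : dirDeriv b (r • w) = (r : ℂ) • dirDeriv b w :=
    dirDeriv_ext (by simp [dirDeriv, mkDerivation_X, smul_eq_C_mul])
      (by simp [dirDeriv, mkDerivation_X, smul_eq_C_mul])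
  simp only [dunkl, this, inner_smul_right, Complex.ofReal_mul, smul_sub, Finset.smul_sum,
    smul_smul, Derivation.coe_smul_linearMap]
  congr 1
  refine Finset.sum_congr rfl fun s _ => ?_
  congr 1
  ring

theorem dunkl_lin_mul (w z : E) (p : MvPolynomial (Fin 2) ℂ) :
    dunkl b c w (lin b z * p) = lin b z * dunkl b c w p + ((inner ℝ z w : ℝ) : ℂ) • p
      - ∑ s : reflections G, (((inner ℝ z (w - ((s : G) : E ≃ₗᵢ[ℝ] E) w) : ℝ) : ℂ) * c s) •
        act b ((s : G) : E ≃ₗᵢ[ℝ] E) p := by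
  have hs : ∀ s : reflections G, (c s * ((inner ℝ (root s) w : ℝ) : ℂ)) • divDiff b s (lin b z * p)
      = lin b z * ((c s * ((inner ℝ (root s) w : ℝ) : ℂ)) • divDiff b s p)
        + (((inner ℝ z (w - ((s : G) : E ≃ₗᵢ[ℝ] E) w) : ℝ) : ℂ) * c s) •
        act b ((s : G) : E ≃ₗᵢ[ℝ] E) p := by
    intro s
    rw [divDiff_lin_mul, ← root_coeff, ← smul_eq_C_mul, smul_add, smul_smul, mul_smul_comm,
      real_inner_comm z (root s)]
    congr 2
    push_cast
    ring
  rw [dunkl_apply, dunkl_apply, Derivation.leibniz, dirDeriv_lin, Finset.sum_congr rfl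
    fun s _ => hs s, Finset.sum_add_distrib, ← Finset.mul_sum, smul_eq_mul, smul_eq_mul,
    smul_eq_C_mul]
  ring

theorem act_dunkl (hc : ∀ s t : reflections G, IsConj (s : G) (t : G) → c s = c t) (g : G) (w : E) :
    actHom b g * dunkl b c w = dunkl b c ((g : E ≃ₗᵢ[ℝ] E) w) * actHom b g := by
  refine linearMap_ext_of_lin b ?_ fun z p hp => ?_
  · simp only [Module.End.mul_apply, actHom_apply, map_one, dunkl_one, map_zero]
  · simp only [Module.End.mul_apply, actHom_apply] at hp ⊢
    rw [dunkl_lin_mul, map_mul, act_lin, dunkl_lin_mul, map_sub, map_add, map_mul, act_lin, hp,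
      map_smul, map_sum, LinearIsometryEquiv.inner_map_map]
    congr 1
    refine Fintype.sum_equiv (conjReflectionEquiv g) _ _ fun s => ?_
    have h1 : c s = c (conjReflectionEquiv g s) := hc _ _ (isConj_iff.2 ⟨g, rfl⟩)
    have h2 : (((conjReflectionEquiv g s : reflections G) : G) : E ≃ₗᵢ[ℝ] E)
      = (g : E ≃ₗᵢ[ℝ] E) * ((s : G) : E ≃ₗᵢ[ℝ] E) * (g : E ≃ₗᵢ[ℝ] E)⁻¹ := rfl
    have h3 : ((g : E ≃ₗᵢ[ℝ] E) * ((s : G) : E ≃ₗᵢ[ℝ] E) * (g : E ≃ₗᵢ[ℝ] E)⁻¹)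
        ((g : E ≃ₗᵢ[ℝ] E) w) = (g : E ≃ₗᵢ[ℝ] E) (((s : G) : E ≃ₗᵢ[ℝ] E) w) := by
      change (g : E ≃ₗᵢ[ℝ] E) (((s : G) : E ≃ₗᵢ[ℝ] E)
        ((g : E ≃ₗᵢ[ℝ] E).symm ((g : E ≃ₗᵢ[ℝ] E) w))) = _
      rw [LinearIsometryEquiv.symm_apply_apply]
    rw [h1, h2, h3, ← map_sub, LinearIsometryEquiv.inner_map_map, map_smul, ← act_mul, ← act_mul,
      inv_mul_cancel_right]

theorem dunkl_comm (hc : ∀ s t : reflections G, IsConj (s : G) (t : G) → c s = c t) (w z : E) :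
    dunkl b c w * dunkl b c z = dunkl b c z * dunkl b c w := by
  refine linearMap_ext_of_lin b ?_ fun y p hp => ?_
  · simp only [Module.End.mul_apply, dunkl_one, map_zero]
  · simp only [Module.End.mul_apply] at hp ⊢
    have hact : ∀ (w : E) (s : reflections G), dunkl b c w (act b ((s : G) : E ≃ₗᵢ[ℝ] E) p)
        = act b ((s : G) : E ≃ₗᵢ[ℝ] E) (dunkl b c w p)
          + dunkl b c (w - ((s : G) : E ≃ₗᵢ[ℝ] E) w) (act b ((s : G) : E ≃ₗᵢ[ℝ] E) p) := by
      intro w s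
      have := LinearMap.congr_fun (act_dunkl b c hc s w) p
      simp only [Module.End.mul_apply, actHom_apply] at this
      rw [this, ← LinearMap.add_apply, ← dunkl_add, add_sub_cancel]
    -- Both w - sw and z - sz are multiples of the same root, so the only term of `hexp` not visibly
    -- symmetric in w and z is symmetric after all.
    have hsym : ∀ s : reflections G,
        (((inner ℝ y (z - ((s : G) : E ≃ₗᵢ[ℝ] E) z) : ℝ) : ℂ) * c s) •
          dunkl b c (w - ((s : G) : E ≃ₗᵢ[ℝ] E) w) (act b ((s : G) : E ≃ₗᵢ[ℝ] E) p)
        = (((inner ℝ y (w - ((s : G) : E ≃ₗᵢ[ℝ] E) w) : ℝ) : ℂ) * c s) •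
          dunkl b c (z - ((s : G) : E ≃ₗᵢ[ℝ] E) z) (act b ((s : G) : E ≃ₗᵢ[ℝ] E) p) := by
      intro s
      have hw : ∀ w, w - ((s : G) : E ≃ₗᵢ[ℝ] E) w
          = (2 * (inner ℝ (root s) w / inner ℝ (root s) (root s))) • root s := fun w => by
        rw [reflection_apply, sub_sub_cancel]
      rw [hw, hw, dunkl_smul, dunkl_smul, LinearMap.smul_apply, LinearMap.smul_apply, smul_smul,
        smul_smul, inner_smul_right, inner_smul_right]
      congr 1
      push_cast
      ring
    have hexp : ∀ w z : E, dunkl b c w (dunkl b c z (lin b y * p))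
        = lin b y * dunkl b c w (dunkl b c z p) + ((inner ℝ y w : ℝ) : ℂ) • dunkl b c z p
        - (∑ s : reflections G, (((inner ℝ y (w - ((s : G) : E ≃ₗᵢ[ℝ] E) w) : ℝ) : ℂ) * c s) •
          act b ((s : G) : E ≃ₗᵢ[ℝ] E) (dunkl b c z p))
        + ((inner ℝ y z : ℝ) : ℂ) • dunkl b c w p
        - (∑ s : reflections G, (((inner ℝ y (z - ((s : G) : E ≃ₗᵢ[ℝ] E) z) : ℝ) : ℂ) * c s) •
          act b ((s : G) : E ≃ₗᵢ[ℝ] E) (dunkl b c w p))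
        - ∑ s : reflections G, (((inner ℝ y (z - ((s : G) : E ≃ₗᵢ[ℝ] E) z) : ℝ) : ℂ) * c s) •
          dunkl b c (w - ((s : G) : E ≃ₗᵢ[ℝ] E) w) (act b ((s : G) : E ≃ₗᵢ[ℝ] E) p) := by
      intro w z
      have hact' := hact w
      rw [dunkl_lin_mul b c z, map_sub, map_add, dunkl_lin_mul, map_smul, map_sum]
      simp only [map_smul, hact', smul_add, Finset.sum_add_distrib]
      abel
    rw [hexp w z, hexp z w, hp, Finset.sum_congr rfl fun s _ => hsym s]
    abel

/-- The polynomial representation of the rational Cherednik algebra by Dunkl operators. -/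
theorem cherednikRel_dunkl (hc : ∀ s t : reflections G, IsConj (s : G) (t : G) → c s = c t) :
    CherednikRel c (fun w => LinearMap.mulLeft ℂ (lin b w)) (dunkl b c) (actHom b) where
  f_add w z := by
    refine LinearMap.ext fun p => ?_
    simp [lin_add, add_mul]
  f_smul r w := by
    refine LinearMap.ext fun p => ?_
    change lin b (r • w) * p = (r : ℂ) • (lin b w * p)
    rw [lin_smul, smul_eq_C_mul, mul_assoc]
  d_add := dunkl_add b c
  d_smul := dunkl_smul b c
  f_mul_f w z := by
    refine LinearMap.ext fun p => ?_
    simp [mul_left_comm]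
  d_mul_d := dunkl_comm b c hc
  γ_mul_f g w := by
    refine LinearMap.ext fun p => ?_
    simp [actHom_apply, act_lin]
  γ_mul_d := act_dunkl b c hc
  d_comm_f w z := by
    refine LinearMap.ext fun p => ?_
    simp only [LinearMap.sub_apply, Module.End.mul_apply, LinearMap.mulLeft_apply, dunkl_lin_mul,
      LinearMap.smul_apply, Module.End.one_apply, LinearMap.sum_apply, actHom_apply]
    abel

end PolynomialRepresentation

/-! ### The elements Z̃₀ and Ω. -/

section Commutation

variable {E : Type*} [NormedAddCommGroup E] [InnerProductSpace ℝ E]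
variable {G : Subgroup (E ≃ₗᵢ[ℝ] E)} [Fintype (reflections G)]
variable {R : Type*} [Ring R] [Algebra ℂ R]

/-- The element `Z₀ + ε σ`. -/
def relZt (b : OrthonormalBasis (Fin 2) ℝ E) (c : reflections G → ℂ) (f d : E → R) (γ : G →* R)
    (ε : ℝ) : R :=
  relZ b f d + (ε : ℂ) • relSigma c γ

/-- The element `Z₀ ^ 2 + σ ^ 2`. -/
def relOmega (b : OrthonormalBasis (Fin 2) ℝ E) (c : reflections G → ℂ) (f d : E → R)
    (γ : G →* R) : R :=
  relZ b f d ^ 2 + relSigma c γ ^ 2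

namespace CherednikRel

variable {c : reflections G → ℂ} {f d : E → R} {γ : G →* R} (h : CherednikRel c f d γ)
  (hc : ∀ s t : reflections G, IsConj (s : G) (t : G) → c s = c t)
  (b : OrthonormalBasis (Fin 2) ℝ E) (ε : ℝ)
include h

theorem sigma_sq_commute_Z : Commute (relSigma c γ ^ 2) (relZ b f d) := by
  change relSigma c γ ^ 2 * relZ b f d = relZ b f d * relSigma c γ ^ 2
  rw [sq, mul_assoc, h.sigma_mul_Z, mul_neg, ← mul_assoc, h.sigma_mul_Z, neg_mul, neg_neg,
    mul_assoc]

theorem Z_sq_commute_sigma : Commute (relZ b f d ^ 2) (relSigma c γ) := by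
  have := h.sigma_mul_Z b
  change relZ b f d ^ 2 * relSigma c γ = relSigma c γ * relZ b f d ^ 2
  rw [sq, ← mul_assoc, this, neg_mul, mul_assoc, mul_assoc, this, mul_neg, neg_neg]

theorem omega_commute_Z : Commute (relOmega b c f d γ) (relZ b f d) :=
  Commute.add_left ((Commute.refl _).pow_left 2) (h.sigma_sq_commute_Z b)

theorem omega_commute_sigma : Commute (relOmega b c f d γ) (relSigma c γ) :=
  Commute.add_left (h.Z_sq_commute_sigma b) ((Commute.refl _).pow_left 2)

theorem omega_commute_Zt : Commute (relOmega b c f d γ) (relZt b c f d γ ε) :=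
  Commute.add_right (h.omega_commute_Z b) ((h.omega_commute_sigma b).smul_right _)

include hc in
theorem omega_commute_γ (g : G) : Commute (relOmega b c f d γ) (γ g) := by
  refine Commute.add_left ?_ (Commute.pow_left (γ_mul_sigma hc g).symm 2)
  change relZ b f d ^ 2 * γ g = γ g * relZ b f d ^ 2
  rcases isRot_or_isRef b g with hg | hg
  · have := h.γ_mul_Z_of_isRot b hg
    rw [sq, ← mul_assoc, this, mul_assoc, mul_assoc, this]
  · have := h.γ_mul_Z_of_isRef b hg
    rw [sq, ← mul_assoc, this, neg_mul, mul_assoc, mul_assoc, this, mul_neg, neg_neg]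

/-- The cross terms cancel because σ anticommutes with Z₀. Read backwards, this expresses Ω by Z̃₀
and σ². -/
theorem Zt_sq : relZt b c f d γ ε ^ 2
    = relOmega b c f d γ + ((ε : ℂ) ^ 2 - 1) • relSigma c γ ^ 2 := by
  have := h.sigma_mul_Z b
  simp only [relZt, relOmega, sq, add_mul, mul_add, smul_mul_assoc, mul_smul_comm, this]
  module

omit h in
theorem Z_mul_Zt : relZ b f d * relZt b c f d γ ε = relOmega b c f d γ
    - (1 + (ε : ℂ) ^ 2) • relSigma c γ ^ 2 + (ε : ℂ) • (relZt b c f d γ ε * relSigma c γ) := by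
  simp only [relZt, relOmega, sq, add_mul, mul_add, smul_mul_assoc, mul_smul_comm]
  module

include hc in
theorem γ_mul_Zt_of_isRot {g : G} (hg : IsRot b (g : E ≃ₗᵢ[ℝ] E)) :
    γ g * relZt b c f d γ ε = relZt b c f d γ ε * γ g := by
  simp only [relZt, mul_add, add_mul, smul_mul_assoc, mul_smul_comm, γ_mul_sigma hc g,
    h.γ_mul_Z_of_isRot b hg]

include hc in
theorem γ_mul_Zt_of_isRef {g : G} (hg : IsRef b (g : E ≃ₗᵢ[ℝ] E)) :
    γ g * relZt b c f d γ ε = (relZt b c f d γ ε - (2 : ℂ) • relZ b f d) * γ g := by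
  simp only [relZt, mul_add, add_mul, sub_mul, smul_mul_assoc, mul_smul_comm, γ_mul_sigma hc g,
    h.γ_mul_Z_of_isRef b hg]
  module

end CherednikRel
end Commutation

/-! ### Independence of exponential polynomials. -/

section ExponentialPolynomials

/-- Linear independence of exponential polynomials whose bases differ by roots of unity. -/
theorem exponential_polynomials_eq_zero {ι : Type*} [Fintype ι] {θ : ι → ℂ}
    (hθ : Function.Injective θ) {N : ℕ} (hN : N ≠ 0) {Θ : ℂ} (hΘ : Θ ≠ 0)
    (hpow : ∀ i, θ i ^ N = Θ) (S : ι → Polynomial ℂ) (a : ℂ) (n₀ : ℕ)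
    (hS : ∀ n ≥ n₀, ∑ i, (S i).eval (a - n) * θ i ^ n = 0) (i : ι) : S i = 0 := by
  -- Along n = r + N(n₀ + j) every θᵢⁿ equals θᵢʳ times the common factor Θ^(n₀+j). After
  -- cancellation a single polynomial has infinitely many roots.
  have h1 : ∀ r : ℕ, ∑ i, Polynomial.C (θ i ^ r) * S i = 0 := by
    intro r
    apply Polynomial.eq_zero_of_infinite_isRoot
    have hinj : Function.Injective fun j : ℕ => a - ((r + N * (n₀ + j) : ℕ) : ℂ) := by
      intro j k hjk
      have : r + N * (n₀ + j) = r + N * (n₀ + k) := by exact_mod_cast sub_right_injective hjk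
      have := Nat.eq_of_mul_eq_mul_left (Nat.pos_of_ne_zero hN) (Nat.add_left_cancel this)
      omega
    refine (Set.infinite_range_of_injective hinj).mono ?_
    rintro _ ⟨j, rfl⟩
    have hle : n₀ ≤ r + N * (n₀ + j) :=
      le_add_left ((Nat.le_add_right _ _).trans (Nat.le_mul_of_pos_left _ (Nat.pos_of_ne_zero hN)))
    have := hS _ hle
    simp only [pow_add, pow_mul, hpow] at this
    simp only [Set.mem_ofPred_eq, Polynomial.IsRoot.def, Polynomial.eval_finsetSum,
      Polynomial.eval_mul, Polynomial.eval_C]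
    have h2 : (∑ i, θ i ^ r * (S i).eval (a - ((r + N * (n₀ + j) : ℕ) : ℂ)))
        * (Θ ^ n₀ * Θ ^ j) = 0 := by
      rw [← this, Finset.sum_mul]
      exact Finset.sum_congr rfl fun i _ => by ring
    exact (mul_eq_zero.1 h2).resolve_right (mul_ne_zero (pow_ne_zero _ hΘ) (pow_ne_zero _ hΘ))
  -- Distinct characters r ↦ θᵢʳ of ℕ are independent (Dedekind). This is applied to each
  -- coefficient of the Sᵢ separately.
  have hli : LinearIndependent ℂ fun i => ((powersHom ℂ (θ i) : Multiplicative ℕ →* ℂ) :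
      Multiplicative ℕ → ℂ) :=
    (linearIndependent_monoidHom (Multiplicative ℕ) ℂ).comp (fun i => powersHom ℂ (θ i))
      fun i j hij => hθ ((powersHom ℂ).injective hij)
  ext k
  refine Fintype.linearIndependent_iff.1 hli (fun i => (S i).coeff k) ?_ i
  ext r
  have := congrArg (fun p => Polynomial.coeff p k) (h1 (Multiplicative.toAdd r))
  simp only [Polynomial.finsetSum_coeff, Polynomial.coeff_C_mul, Polynomial.coeff_zero] at this
  simp only [Finset.sum_apply, Pi.smul_apply, powersHom_apply, smul_eq_mul, Pi.zero_apply]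
  rw [← this]
  exact Finset.sum_congr rfl fun i _ => mul_comm _ _

theorem eq_zero_of_even_add_odd {P Q : Polynomial ℂ}
    (h : P.comp (Polynomial.X ^ 2) + Polynomial.X * Q.comp (Polynomial.X ^ 2) = 0) :
    P = 0 ∧ Q = 0 := by
  simp only [← Polynomial.expand_eq_comp_X_pow] at h
  constructor
  · ext k
    have := congrArg (fun p => Polynomial.coeff p (2 * k)) h
    cases k with
    | zero => simpa [Polynomial.coeff_expand] using this
    | succ k =>
      have h1 : ¬ 2 ∣ 2 * k + 1 := by omega
      simpa [mul_add, Polynomial.coeff_X_mul, Polynomial.coeff_expand, h1,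
        show (2 * k + 2) / 2 = k + 1 by omega, show 2 ∣ 2 * k + 2 by omega] using this
  · ext k
    have := congrArg (fun p => Polynomial.coeff p (2 * k + 1)) h
    simpa [Polynomial.coeff_X_mul, Polynomial.coeff_expand,
      show ¬ 2 ∣ 2 * k + 1 by omega] using this

end ExponentialPolynomials

/-! ### Restriction of the operators to the two isotropic lines. -/

section Functionals

open MvPolynomial

variable {E : Type*} [NormedAddCommGroup E] [InnerProductSpace ℝ E]
variable (b : OrthonormalBasis (Fin 2) ℝ E)

/-- Restriction of a polynomial to the first isotropic line. -/
def resPlus : MvPolynomial (Fin 2) ℂ →ₐ[ℂ] Polynomial ℂ := aeval ![Polynomial.X, 0]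

/-- Restriction of a polynomial to the second isotropic line. -/
def resMinus : MvPolynomial (Fin 2) ℂ →ₐ[ℂ] Polynomial ℂ := aeval ![0, Polynomial.X]

@[simp] theorem resPlus_X0 : resPlus (X 0) = Polynomial.X := by simp [resPlus]
@[simp] theorem resPlus_X1 : resPlus (X 1) = 0 := by simp [resPlus]
@[simp] theorem resMinus_X0 : resMinus (X 0) = 0 := by simp [resMinus]
@[simp] theorem resMinus_X1 : resMinus (X 1) = Polynomial.X := by simp [resMinus]
@[simp] theorem resPlus_C (a : ℂ) : resPlus (C a) = Polynomial.C a := resPlus.commutes a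
@[simp] theorem resMinus_C (a : ℂ) : resMinus (C a) = Polynomial.C a := resMinus.commutes a

theorem resPlus_euler (p : MvPolynomial (Fin 2) ℂ) :
    resPlus (X 0 * pderiv 0 p) = Polynomial.X * Polynomial.derivative (resPlus p) := by
  induction p using MvPolynomial.induction_on with
  | C a => simp
  | add p q hp hq => simp only [map_add, mul_add, hp, hq]
  | mul_X p i hp =>
    rw [Derivation.leibniz, mul_add]
    simp only [smul_eq_mul, map_add, map_mul, resPlus_X0] at hp ⊢
    fin_cases i
    · simp
      linear_combination Polynomial.X * hp
    · simp

theorem zc_of_isRot {g : E ≃ₗᵢ[ℝ] E} (hg : IsRot b g) :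
    zc b (g (b 1)) = Complex.I * zc b (g (b 0)) := by
  obtain ⟨p, q, -, h0, h1⟩ := hg
  rw [h0, h1]
  simp only [map_add, map_smul, zc_zero, zc_one, Complex.real_smul]
  push_cast
  linear_combination (-q : ℂ) * Complex.I_sq

theorem zc_of_isRef {g : E ≃ₗᵢ[ℝ] E} (hg : IsRef b g) :
    zc b (g (b 1)) = -Complex.I * zc b (g (b 0)) := by
  obtain ⟨p, q, -, h0, h1⟩ := hg
  rw [h0, h1]
  simp only [map_add, map_smul, zc_zero, zc_one, Complex.real_smul]
  push_cast
  linear_combination (q : ℂ) * Complex.I_sq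

theorem star_mul_zc (g : E ≃ₗᵢ[ℝ] E) : star (zc b (g (b 0))) * zc b (g (b 0)) = 1 := by
  have := inner_eq_zc b (g (b 0)) (g (b 0))
  rw [g.inner_map_map, inner_basis, if_pos rfl] at this
  push_cast at this
  linear_combination -this

/-- Orientation reversing isometries are antilinear in the coordinate `zc`, so they exchange the two
isotropic forms up to a unit scalar. Consequently they exchange `resPlus` and `resMinus` up to
rescaling. -/
theorem act_X0_of_isRef {g : E ≃ₗᵢ[ℝ] E} (hg : IsRef b g) :
    act b g (X 0) = C (zc b (g (b 0))) * X 1 := by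
  have h0 : act b g (X 0) = lin b (g (b 0)) + C Complex.I * lin b (g (b 1)) := by simp [act]
  rw [h0, lin, lin, zc_of_isRef b hg]
  simp only [star_mul', Complex.star_def, star_neg, map_neg, Complex.conj_I, C_mul]
  linear_combination (-C (1/2) * C (zc b (g (b 0))) * X 1
    + C (1/2) * C ((starRingEnd ℂ) (zc b (g (b 0)))) * X 0) * C_I_mul
    + (C (zc b (g (b 0))) * X 1) * C_half

theorem act_X1_of_isRef {g : E ≃ₗᵢ[ℝ] E} (hg : IsRef b g) :
    act b g (X 1) = C (star (zc b (g (b 0)))) * X 0 := by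
  have h0 : act b g (X 1) = lin b (g (b 0)) - C Complex.I * lin b (g (b 1)) := by simp [act]
  rw [h0, lin, lin, zc_of_isRef b hg]
  simp only [star_mul', Complex.star_def, star_neg, map_neg, Complex.conj_I, C_mul]
  linear_combination (C (1/2) * C (zc b (g (b 0))) * X 1
    - C (1/2) * C ((starRingEnd ℂ) (zc b (g (b 0)))) * X 0) * C_I_mul
    + (C ((starRingEnd ℂ) (zc b (g (b 0)))) * X 0) * C_half

theorem algHom_coeff_of_scale {φ ψ : MvPolynomial (Fin 2) ℂ →ₐ[ℂ] Polynomial ℂ} {a : ℂ}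
    (h : ∀ i, φ (X i) = (ψ (X i)).comp (Polynomial.C a * Polynomial.X))
    (p : MvPolynomial (Fin 2) ℂ) (n : ℕ) : (φ p).coeff n = (ψ p).coeff n * a ^ n := by
  have : φ p = (ψ p).comp (Polynomial.C a * Polynomial.X) := by
    induction p using MvPolynomial.induction_on with
    | C a => simp [← MvPolynomial.algebraMap_eq]
    | add p q hp hq => simp [hp, hq]
    | mul_X p i hp => simp [hp, h]
  rw [this, Polynomial.comp_C_mul_X_coeff]

theorem resPlus_act_of_isRef {g : E ≃ₗᵢ[ℝ] E} (hg : IsRef b g) (p : MvPolynomial (Fin 2) ℂ)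
    (n : ℕ) : (resPlus (act b g p)).coeff n
      = (resMinus p).coeff n * star (zc b (g (b 0))) ^ n := by
  refine algHom_coeff_of_scale (φ := resPlus.comp (act b g)) (ψ := resMinus) (fun i => ?_) p n
  fin_cases i
  · simp [act_X0_of_isRef b hg]
  · simp [act_X1_of_isRef b hg]

theorem resMinus_act_of_isRef {g : E ≃ₗᵢ[ℝ] E} (hg : IsRef b g) (p : MvPolynomial (Fin 2) ℂ)
    (n : ℕ) : (resMinus (act b g p)).coeff n = (resPlus p).coeff n * zc b (g (b 0)) ^ n := by
  refine algHom_coeff_of_scale (φ := resMinus.comp (act b g)) (ψ := resPlus) (fun i => ?_) p n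
  fin_cases i
  · simp [act_X0_of_isRef b hg]
  · simp [act_X1_of_isRef b hg]

variable {G : Subgroup (E ≃ₗᵢ[ℝ] E)} [Fintype (reflections G)] (c : reflections G → ℂ)

/-- The operator `Z₀` in the polynomial representation. -/
def opZ : Module.End ℂ (MvPolynomial (Fin 2) ℂ) :=
  relZ b (fun w => LinearMap.mulLeft ℂ (lin b w)) (dunkl b c)

theorem opZ_apply (p : MvPolynomial (Fin 2) ℂ) : opZ b c p
    = -(X 0 * pderiv 0 p) + X 1 * pderiv 1 p - ∑ s : reflections G, C (c s) *
      ((C (-(1 / 2) * star (zc b (root s))) * X 0 + C (1 / 2 * zc b (root s)) * X 1)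
        * divDiff b s p) := by
  have hd : ∀ w, dirDeriv b w p = C (zc b w) * pderiv 0 p + C (star (zc b w)) * pderiv 1 p := by
    intro w
    have : dirDeriv b w = zc b w • pderiv 0 + star (zc b w) • pderiv 1 :=
      dirDeriv_ext (by simp [dirDeriv, mkDerivation_X, smul_eq_C_mul])
        (by simp [dirDeriv, mkDerivation_X, smul_eq_C_mul])
    rw [this, ← smul_eq_C_mul, ← smul_eq_C_mul]; rfl
  have hs : ∀ s : reflections G,
      C Complex.I * (lin b (b 0) * (C (c s * ((inner ℝ (root s) (b 1) : ℝ) : ℂ)) * divDiff b s p)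
        - lin b (b 1) * (C (c s * ((inner ℝ (root s) (b 0) : ℝ) : ℂ)) * divDiff b s p))
      = C (c s) * ((C (-(1 / 2) * star (zc b (root s))) * X 0 + C (1 / 2 * zc b (root s)) * X 1)
        * divDiff b s p) := by
    intro s
    rw [lin_zero_eq, lin_one_eq, zc_apply]
    simp only [Complex.star_def, map_add, map_mul, Complex.conj_ofReal, Complex.conj_I,
      C_neg, real_inner_comm (root s)]
    linear_combination (C (1 / 2) * C (c s) * C ((inner ℝ (root s) (b 0) : ℝ) : ℂ)
      * (X 0 - X 1) * divDiff b s p) * C_I_mul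
  have : opZ b c p = C Complex.I * (lin b (b 0) * dunkl b c (b 1) p
      - lin b (b 1) * dunkl b c (b 0) p) := by
    rw [← smul_eq_C_mul]; rfl
  rw [this, dunkl_apply, dunkl_apply, hd, hd]
  simp only [smul_eq_C_mul]
  rw [mul_sub (lin b (b 0)), mul_sub (lin b (b 1)), sub_sub_sub_comm, mul_sub (C Complex.I), Finset.mul_sum, Finset.mul_sum,
    ← Finset.sum_sub_distrib, Finset.mul_sum, Finset.sum_congr rfl fun s _ => hs s]
  congr 1
  rw [lin_zero_eq, lin_one_eq]
  simp only [zc_zero, zc_one, star_one, Complex.star_def, Complex.conj_I, C_neg, C_1]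
  linear_combination (C (1 / 2) * (2 * X 0 * pderiv 0 p - 2 * X 1 * pderiv 1 p)) * C_I_mul
    + (X 1 * pderiv 1 p - X 0 * pderiv 0 p) * C_half

/-- The operator `σ` in the polynomial representation. -/
def opSigma : Module.End ℂ (MvPolynomial (Fin 2) ℂ) := relSigma c (actHom b)

theorem opSigma_apply (p : MvPolynomial (Fin 2) ℂ) :
    opSigma b c p = ∑ s : reflections G, C (c s) * act b ((s : G) : E ≃ₗᵢ[ℝ] E) p := by
  simp [opSigma, relSigma, LinearMap.sum_apply, actHom_apply, smul_eq_C_mul]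

theorem coeff_X_mul_derivative (q : Polynomial ℂ) (n : ℕ) :
    (Polynomial.X * Polynomial.derivative q).coeff n = n * q.coeff n := by
  cases n with
  | zero => simp
  | succ n => rw [Polynomial.coeff_X_mul, Polynomial.coeff_derivative]; push_cast; ring

/-- On the line X 1 = 0 the linear factor before `divDiff` becomes minus the root itself. The
division disappears and only p - sp is left. The Euler operator contributes -n. -/
theorem resPlus_opZ (p : MvPolynomial (Fin 2) ℂ) (n : ℕ) : (resPlus (opZ b c p)).coeff n
    = ((∑ s, c s) - n) * (resPlus p).coeff n - (resPlus (opSigma b c p)).coeff n := by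
  have hs : ∀ s : reflections G, resPlus (C (c s) *
      ((C (-(1 / 2) * star (zc b (root s))) * X 0 + C (1 / 2 * zc b (root s)) * X 1)
        * divDiff b s p)) = Polynomial.C (c s) * resPlus (act b ((s : G) : E ≃ₗᵢ[ℝ] E) p)
        - Polynomial.C (c s) * resPlus p := by
    intro s
    have := congrArg resPlus (lin_mul_divDiff b s p)
    rw [lin] at this
    simp only [map_sub, map_add, map_mul, resPlus_C, resPlus_X0, resPlus_X1, mul_zero, add_zero,
      neg_mul, map_neg] at this ⊢
    linear_combination -Polynomial.C (c s) * this
  rw [opZ_apply, opSigma_apply, map_sub, map_sum, map_sum, Finset.sum_congr rfl fun s _ => hs s,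
    map_add, map_neg, resPlus_euler, map_mul, resPlus_X1, zero_mul, add_zero,
    Finset.sum_sub_distrib, ← Finset.sum_mul, ← map_sum]
  simp only [Polynomial.coeff_sub, Polynomial.coeff_neg, coeff_X_mul_derivative,
    Polynomial.coeff_C_mul, map_mul, resPlus_C]
  ring

theorem resPlus_opSigma (p : MvPolynomial (Fin 2) ℂ) (n : ℕ) : (resPlus (opSigma b c p)).coeff n
    = (∑ s : reflections G, c s * star (zc b (((s : G) : E ≃ₗᵢ[ℝ] E) (b 0))) ^ n)
      * (resMinus p).coeff n := by
  rw [opSigma_apply, map_sum, Polynomial.finsetSum_coeff, Finset.sum_mul]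
  refine Finset.sum_congr rfl fun s _ => ?_
  rw [map_mul, resPlus_C, Polynomial.coeff_C_mul,
    resPlus_act_of_isRef b (isRef_reflection b s)]
  ring

theorem resMinus_opSigma (p : MvPolynomial (Fin 2) ℂ) (n : ℕ) :
    (resMinus (opSigma b c p)).coeff n
    = (∑ s : reflections G, c s * zc b (((s : G) : E ≃ₗᵢ[ℝ] E) (b 0)) ^ n)
      * (resPlus p).coeff n := by
  rw [opSigma_apply, map_sum, Polynomial.finsetSum_coeff, Finset.sum_mul]
  refine Finset.sum_congr rfl fun s _ => ?_
  rw [map_mul, resMinus_C, Polynomial.coeff_C_mul,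
    resMinus_act_of_isRef b (isRef_reflection b s)]
  ring

end Functionals

/-! ### Vanishing of the orientation reversing part in the polynomial representation. -/

section Independence

theorem commute_aeval {R : Type*} [Ring R] [Algebra ℂ R] {x y : R} (h : Commute x y)
    (P : Polynomial ℂ) : Commute x (Polynomial.aeval y P) := by
  induction P using Polynomial.induction_on' with
  | add p q hp hq => rw [map_add]; exact hp.add_right hq
  | monomial n a =>
    rw [Polynomial.aeval_monomial]
    exact (Algebra.commute_algebraMap_right a x).mul_right (h.pow_right n)

variable {E : Type*} [NormedAddCommGroup E] [InnerProductSpace ℝ E]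
variable (b : OrthonormalBasis (Fin 2) ℝ E)

theorem zc_map_of_isRef {g : E ≃ₗᵢ[ℝ] E} (hg : IsRef b g) (w : E) :
    zc b (g w) = zc b (g (b 0)) * star (zc b w) := by
  conv_lhs => rw [← basis_expansion b w]
  rw [map_add, map_smul, map_smul, map_add, map_smul, map_smul, zc_of_isRef b hg, zc_apply b w]
  simp only [Complex.real_smul, Complex.star_def, map_add, map_mul, Complex.conj_ofReal,
    Complex.conj_I]
  ring

theorem ext_of_isRef {g k : E ≃ₗᵢ[ℝ] E} (hg : IsRef b g) (hk : IsRef b k)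
    (h : zc b (g (b 0)) = zc b (k (b 0))) : g = k := by
  ext w
  by_contra hne
  refine zc_ne_zero b (sub_ne_zero.2 hne) ?_
  rw [map_sub, zc_map_of_isRef b hg, zc_map_of_isRef b hk, h, sub_self]

/-- The two numbers differ by the multiplier of the rotation gk, which is a root of unity of order
dividing |G|. -/
theorem star_zc_pow_card {G : Subgroup (E ≃ₗᵢ[ℝ] E)} {g k : G}
    (hg : IsRef b (g : E ≃ₗᵢ[ℝ] E)) (hk : IsRef b (k : E ≃ₗᵢ[ℝ] E)) :
    star (zc b ((g : E ≃ₗᵢ[ℝ] E) (b 0))) ^ Nat.card G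
      = star (zc b ((k : E ≃ₗᵢ[ℝ] E) (b 0))) ^ Nat.card G := by
  set χ := zc b ((g : E ≃ₗᵢ[ℝ] E) (b 0)) * star (zc b ((k : E ≃ₗᵢ[ℝ] E) (b 0))) with hχ
  have h1 : ∀ w, zc b (((g * k : G) : E ≃ₗᵢ[ℝ] E) w) = χ * zc b w := by
    intro w
    change zc b ((g : E ≃ₗᵢ[ℝ] E) ((k : E ≃ₗᵢ[ℝ] E) w)) = _
    rw [zc_map_of_isRef b hg, zc_map_of_isRef b hk, star_mul', star_star, hχ, mul_assoc]
  have h2 : ∀ n w, zc b ((((g * k) ^ n : G) : E ≃ₗᵢ[ℝ] E) w) = χ ^ n * zc b w := by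
    intro n
    induction n with
    | zero => intro w; rw [pow_zero, pow_zero, one_mul]; rfl
    | succ n ih =>
      intro w
      rw [pow_succ]
      change zc b ((((g * k) ^ n : G) : E ≃ₗᵢ[ℝ] E) (((g * k : G) : E ≃ₗᵢ[ℝ] E) w)) = _
      rw [ih, h1, pow_succ]
      ring
  have h3 : χ ^ Nat.card G = 1 := by
    have := h2 (Nat.card G) (b 0)
    rw [pow_card_eq_one', zc_zero, mul_one] at this
    rw [← this]
    exact zc_zero b
  have e := star_mul_zc b (g : E ≃ₗᵢ[ℝ] E)
  have : star (zc b ((g : E ≃ₗᵢ[ℝ] E) (b 0))) * χ = star (zc b ((k : E ≃ₗᵢ[ℝ] E) (b 0))) := by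
    rw [hχ, ← mul_assoc, e, one_mul]
  rw [← this, mul_pow, h3, mul_one]

theorem norm_zc (g : E ≃ₗᵢ[ℝ] E) : ‖zc b (g (b 0))‖ = 1 := by
  have := congrArg norm (star_mul_zc b g)
  rw [norm_mul, norm_star, norm_one, ← sq] at this
  exact (pow_eq_one_iff_of_nonneg (norm_nonneg _) two_ne_zero).1 this

variable {G : Subgroup (E ≃ₗᵢ[ℝ] E)} [Fintype (reflections G)] (c : reflections G → ℂ)
  (hc : ∀ s t : reflections G, IsConj (s : G) (t : G) → c s = c t)

/-- The operator `Z₀ ^ 2 + σ ^ 2` in the polynomial representation. -/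
def opOmega : Module.End ℂ (MvPolynomial (Fin 2) ℂ) :=
  relOmega b c (fun w => LinearMap.mulLeft ℂ (lin b w)) (dunkl b c) (actHom b)

/-- The operator `Z₀ + ε σ` in the polynomial representation. -/
def opZt (ε : ℝ) : Module.End ℂ (MvPolynomial (Fin 2) ℂ) :=
  relZt b c (fun w => LinearMap.mulLeft ℂ (lin b w)) (dunkl b c) (actHom b) ε

theorem opZt_apply (ε : ℝ) (p : MvPolynomial (Fin 2) ℂ) :
    opZt b c ε p = opZ b c p + (ε : ℂ) • opSigma b c p := rfl

include hc

/-- With λ = ∑ c - n, the n-th coefficient of Z₀²p is that of λ²p - σ²p. The terms λσp cancel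
because σ anticommutes with Z₀. Adding σ² diagonalises the action. -/
theorem resPlus_opOmega (p : MvPolynomial (Fin 2) ℂ) (n : ℕ) :
    (resPlus (opOmega b c p)).coeff n = ((∑ s, c s) - n) ^ 2 * (resPlus p).coeff n := by
  have h1 : opOmega b c p = opZ b c (opZ b c p) + opSigma b c (opSigma b c p) := by
    change (opZ b c ^ 2 + opSigma b c ^ 2) p = _
    rw [sq, sq]; rfl
  have h2 : opSigma b c (opZ b c p) = -opZ b c (opSigma b c p) :=
    LinearMap.congr_fun ((cherednikRel_dunkl b c hc).sigma_mul_Z b) p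
  rw [h1, map_add, Polynomial.coeff_add, resPlus_opZ, h2, map_neg, Polynomial.coeff_neg,
    resPlus_opZ, resPlus_opZ]
  ring

theorem resPlus_aeval_opOmega (P : Polynomial ℂ) (p : MvPolynomial (Fin 2) ℂ) (n : ℕ) :
    (resPlus (Polynomial.aeval (opOmega b c) P p)).coeff n
      = P.eval (((∑ s, c s) - n) ^ 2) * (resPlus p).coeff n := by
  induction P using Polynomial.induction_on generalizing p with
  | C a => simp [Module.algebraMap_end_apply]
  | add P Q hP hQ =>
    rw [map_add, LinearMap.add_apply, map_add, Polynomial.coeff_add, hP, hQ, Polynomial.eval_add]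
    ring
  | monomial k a ih =>
    rw [pow_succ, ← mul_assoc, map_mul, Module.End.mul_apply, ih, Polynomial.aeval_X,
      resPlus_opOmega b c hc]
    simp only [Polynomial.eval_mul, Polynomial.eval_X]
    ring

/-- Z₀² = Ω - σ² commutes with T, so Z₀²T = 0. On the n-th coefficient Z₀² is multiplication by a
nonzero number once n is large, so T kills these coefficients. Evaluating T on powers of X 1 gives
an exponential polynomial whose bases are separated by g. -/
theorem eq_zero_of_mul_opZ_eq_zero [Fintype {g : G // IsRef b (g : E ≃ₗᵢ[ℝ] E)}] (ε : ℝ)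
    (hG : Nat.card G ≠ 0) (P Q : {g : G // IsRef b (g : E ≃ₗᵢ[ℝ] E)} → Polynomial ℂ)
    (hT : (∑ g, (Polynomial.aeval (opOmega b c) (P g)
      + Polynomial.aeval (opOmega b c) (Q g) * opZt b c ε) * actHom b g.1) * opZ b c = 0)
    (g : {g : G // IsRef b (g : E ≃ₗᵢ[ℝ] E)}) : P g = 0 ∧ Q g = 0 := by
  have h := cherednikRel_dunkl b c hc
  set T := ∑ g, (Polynomial.aeval (opOmega b c) (P g)
      + Polynomial.aeval (opOmega b c) (Q g) * opZt b c ε) * actHom b g.1 with hTdef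
  have hcomm : ∀ {u : Module.End ℂ (MvPolynomial (Fin 2) ℂ)}, Commute u (opOmega b c) →
      Commute u (opZt b c ε) → (∀ g : G, Commute u (actHom b g)) → Commute u T := fun h1 h2 h3 =>
    Commute.sum_right _ _ _ fun g _ => ((commute_aeval h1 _).add_right
      ((commute_aeval h1 _).mul_right h2)).mul_right (h3 g.1)
  have hΩT : Commute (opOmega b c) T := hcomm (Commute.refl _) (h.omega_commute_Zt b ε)
    fun g => h.omega_commute_γ hc b g
  have hσ : ∀ g : G, Commute (opSigma b c) (actHom b g) := fun g =>
    (CherednikRel.γ_mul_sigma hc g).symm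
  have hσT : Commute (opSigma b c ^ 2) T :=
    hcomm ((h.omega_commute_sigma b).symm.pow_left 2)
      (Commute.add_right (h.sigma_sq_commute_Z b) (((Commute.refl _).pow_left 2).smul_right _))
      fun g => (hσ g).pow_left 2
  have hZT : (opOmega b c - opSigma b c ^ 2) * T = 0 := by
    rw [sub_mul, hΩT.eq, hσT.eq, ← mul_sub]
    have : opOmega b c - opSigma b c ^ 2 = opZ b c * opZ b c := by
      rw [← sq]; exact add_sub_cancel_right _ _
    rw [this, ← mul_assoc, hT, zero_mul]
  set M := ∑ s, ‖c s‖ with hM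
  have hM0 : 0 ≤ M := Finset.sum_nonneg fun s _ => norm_nonneg _
  -- On coefficient n the operator Ω - σ² multiplies by (∑ c - n)² minus a product of two sums, each
  -- of norm at most M because the multipliers have norm 1.
  have hvan : ∀ n : ℕ, M < ‖(∑ s, c s) - n‖ → ∀ p, (resPlus (T p)).coeff n = 0 := by
    intro n hn p
    have h1 := congrArg (fun q => (resPlus q).coeff n) (LinearMap.congr_fun hZT p)
    have h2 : ((opOmega b c - opSigma b c ^ 2) * T) p
        = opOmega b c (T p) - opSigma b c (opSigma b c (T p)) := by rw [sq]; rfl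
    simp only [h2, map_sub, Polynomial.coeff_sub, resPlus_opOmega b c hc, resPlus_opSigma,
      resMinus_opSigma, LinearMap.zero_apply, map_zero, Polynomial.coeff_zero, ← mul_assoc,
      ← sub_mul] at h1
    refine (mul_eq_zero.1 h1).resolve_left fun h0 => ?_
    have hb1 : ‖∑ s : reflections G, c s * star (zc b (((s : G) : E ≃ₗᵢ[ℝ] E) (b 0))) ^ n‖ ≤ M := by
      refine (norm_sum_le _ _).trans (Finset.sum_le_sum fun s _ => ?_)
      rw [norm_mul, norm_pow, norm_star, norm_zc, one_pow, mul_one]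
    have hb2 : ‖∑ s : reflections G, c s * zc b (((s : G) : E ≃ₗᵢ[ℝ] E) (b 0)) ^ n‖ ≤ M := by
      refine (norm_sum_le _ _).trans (Finset.sum_le_sum fun s _ => ?_)
      rw [norm_mul, norm_pow, norm_zc, one_pow, mul_one]
    have h3 := congrArg norm (sub_eq_zero.1 h0)
    rw [norm_pow, norm_mul] at h3
    have h4 : ‖(∑ s, c s) - n‖ ^ 2 ≤ M ^ 2 := by
      rw [h3, sq]; exact mul_le_mul hb1 hb2 (norm_nonneg _) hM0
    exact absurd (le_of_sq_le_sq h4 hM0) (not_le.2 hn)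
  have hθ : Function.Injective fun g : {g : G // IsRef b (g : E ≃ₗᵢ[ℝ] E)} =>
      star (zc b ((g.1 : E ≃ₗᵢ[ℝ] E) (b 0))) := fun g k hgk =>
    Subtype.ext (Subtype.ext (ext_of_isRef b g.2 k.2 (star_injective hgk)))
  have hΘ : star (zc b ((g.1 : E ≃ₗᵢ[ℝ] E) (b 0))) ^ Nat.card G ≠ 0 :=
    pow_ne_zero _ fun h0 => by simpa [h0] using star_mul_zc b (g.1 : E ≃ₗᵢ[ℝ] E)
  -- Beyond this bound ‖∑ c - n‖ exceeds M. Starting at n₀ + 1 also ensures n ≠ 0, which is needed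
  -- for `e2`.
  obtain ⟨n₀, hn₀⟩ := exists_nat_gt (M + ‖∑ s, c s‖)
  refine eq_zero_of_even_add_odd (exponential_polynomials_eq_zero hθ hG hΘ
    (fun k => star_zc_pow_card b k.2 g.2)
    (fun k => (P k).comp (Polynomial.X ^ 2) + Polynomial.X * (Q k).comp (Polynomial.X ^ 2))
    (∑ s, c s) (n₀ + 1) (fun n hn => ?_) g)
  have hlt : M < ‖(∑ s, c s) - n‖ := by
    have h1 : (n₀ : ℝ) ≤ n := by exact_mod_cast (Nat.le_succ n₀).trans hn
    have h2 := norm_sub_norm_le (n : ℂ) (∑ s, c s)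
    rw [Complex.norm_natCast, norm_sub_rev] at h2
    linarith
  have hn1 : n ≠ 0 := by omega
  -- The power of X 1 is carried by each g to a multiple of the power of X 0, where Ω acts by λ² and
  -- Z̃₀ by λ = ∑ c - n. The σ terms vanish, since they see only `resMinus`. Hence P_g and Q_g
  -- appear as the even and odd parts of one polynomial in λ.
  rw [← hvan n hlt (MvPolynomial.X 1 ^ n), hTdef, LinearMap.sum_apply, map_sum,
    Polynomial.finsetSum_coeff]
  refine Finset.sum_congr rfl fun k _ => ?_
  have e1 : (resPlus (act b (k.1 : E ≃ₗᵢ[ℝ] E) (MvPolynomial.X 1 ^ n))).coeff n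
      = star (zc b ((k.1 : E ≃ₗᵢ[ℝ] E) (b 0))) ^ n := by
    rw [resPlus_act_of_isRef b k.2, map_pow, resMinus_X1, Polynomial.coeff_X_pow_self, one_mul]
  have e2 : (resMinus (act b (k.1 : E ≃ₗᵢ[ℝ] E) (MvPolynomial.X 1 ^ n))).coeff n = 0 := by
    rw [resMinus_act_of_isRef b k.2, map_pow, resPlus_X1, zero_pow hn1, Polynomial.coeff_zero,
      zero_mul]
  simp only [add_mul, LinearMap.add_apply, Module.End.mul_apply, map_add, Polynomial.coeff_add,
    resPlus_aeval_opOmega b c hc, opZt_apply, map_smul, Polynomial.coeff_smul, resPlus_opZ,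
    resPlus_opSigma, actHom_apply, e1, e2, mul_zero, smul_zero, Polynomial.eval_add,
    Polynomial.eval_mul, Polynomial.eval_comp, Polynomial.eval_pow, Polynomial.eval_X]
  ring

end Independence

/-! ### Normal form and the centraliser of E₊, E₋ and Z̃₀. -/

section Centraliser

variable {E : Type*} [NormedAddCommGroup E] [InnerProductSpace ℝ E]

theorem IsRef.mul (b : OrthonormalBasis (Fin 2) ℝ E) {g k : E ≃ₗᵢ[ℝ] E} (hg : IsRef b g)
    (hk : IsRef b k) : IsRot b (g * k) := by
  rw [isRot_iff_det]
  have : ((g * k).toLinearEquiv : E →ₗ[ℝ] E) = (g.toLinearEquiv : E →ₗ[ℝ] E) ∘ₗ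
      (k.toLinearEquiv : E →ₗ[ℝ] E) := rfl
  rw [this, LinearMap.det_comp, hg.det, hk.det]
  norm_num

variable {G : Subgroup (E ≃ₗᵢ[ℝ] E)} [Fintype (reflections G)]
variable {R : Type*} [Ring R] [Algebra ℂ R]

omit [Fintype (reflections G)] in
theorem toSubmodule_adjoin_range (γ : G →* R) :
    Subalgebra.toSubmodule (Algebra.adjoin ℂ (Set.range γ)) = Submodule.span ℂ (Set.range γ) := by
  rw [Algebra.adjoin_eq_span, ← MonoidHom.coe_mrange, Submonoid.closure_eq]

omit [Fintype (reflections G)] in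
theorem γ_mem_adjoin (γ : G →* R) (g : G) : γ g ∈ Algebra.adjoin ℂ (Set.range γ) :=
  Algebra.subset_adjoin ⟨g, rfl⟩

theorem relSigma_mem_adjoin (c : reflections G → ℂ) (γ : G →* R) :
    relSigma c γ ∈ Algebra.adjoin ℂ (Set.range γ) :=
  sum_mem fun s _ => Subalgebra.smul_mem _ (γ_mem_adjoin γ s) _

namespace CherednikRel

variable {c : reflections G → ℂ} {f d : E → R} {γ : G →* R} (h : CherednikRel c f d γ)
  (hc : ∀ s t : reflections G, IsConj (s : G) (t : G) → c s = c t)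
  (b : OrthonormalBasis (Fin 2) ℝ E) (ε : ℝ)
include h

theorem f_mem_span (w : E) : f w ∈ Submodule.span ℂ {f (b 0), f (b 1), d (b 0), d (b 1)} := by
  rw [← h.sum_inner_f b w]
  exact add_mem (Submodule.smul_mem _ _ (Submodule.subset_span (by simp)))
    (Submodule.smul_mem _ _ (Submodule.subset_span (by simp)))

theorem d_mem_span (w : E) : d w ∈ Submodule.span ℂ {f (b 0), f (b 1), d (b 0), d (b 1)} := by
  rw [← h.swap.sum_inner_f b w]
  exact add_mem (Submodule.smul_mem _ _ (Submodule.subset_span (by simp)))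
    (Submodule.smul_mem _ _ (Submodule.subset_span (by simp)))

theorem d_comm_f_mem (w z : E) : d w * f z - f z * d w ∈ Algebra.adjoin ℂ (Set.range γ) := by
  rw [h.d_comm_f]
  exact sub_mem (Subalgebra.smul_mem _ (one_mem _) _)
    (sum_mem fun s _ => Subalgebra.smul_mem _ (γ_mem_adjoin γ s) _)

theorem slTwoData : SlTwoData (Algebra.adjoin ℂ (Set.range γ)) (f (b 0)) (f (b 1)) (d (b 0))
    (d (b 1)) (relEplus b f) (relEminus b d) where
  span_comm k hk p hp := by
    have hk' : k ∈ Submodule.span ℂ (Set.range γ) := by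
      rw [← toSubmodule_adjoin_range]; exact hk
    set S := Submodule.span ℂ {f (b 0), f (b 1), d (b 0), d (b 1)} *
      Subalgebra.toSubmodule (Algebra.adjoin ℂ (Set.range γ))
    rw [← LinearMap.mulRight_apply (R := ℂ), ← Submodule.mem_comap]
    refine Submodule.span_le.2 ?_ hk'
    rintro _ ⟨g, rfl⟩
    change γ g * p ∈ S
    rw [← LinearMap.mulLeft_apply (R := ℂ), ← Submodule.mem_comap]
    refine Submodule.span_le.2 ?_ hp
    have hf : ∀ w, γ g * f w ∈ S := fun w => by
      rw [h.γ_mul_f]; exact Submodule.mul_mem_mul (h.f_mem_span b _) (γ_mem_adjoin γ g)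
    have hd : ∀ w, γ g * d w ∈ S := fun w => by
      rw [h.γ_mul_d]; exact Submodule.mul_mem_mul (h.d_mem_span b _) (γ_mem_adjoin γ g)
    rintro _ (rfl | rfl | rfl | rfl)
    exacts [hf _, hf _, hd _, hd _]
  xy := h.f_mul_f _ _
  ξη := h.d_mul_d _ _
  ξx := h.d_comm_f_mem _ _
  ξy := h.d_comm_f_mem _ _
  ηx := h.d_comm_f_mem _ _
  ηy := h.d_comm_f_mem _ _
  ux := h.rightComm_Eplus_f b _
  uy := h.rightComm_Eplus_f b _
  uξ := h.rightComm_Eplus_d b _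
  uη := h.rightComm_Eplus_d b _
  vx := h.rightComm_Eminus_f b _
  vy := h.rightComm_Eminus_f b _
  vξ := h.rightComm_Eminus_d b _
  vη := h.rightComm_Eminus_d b _
  uK k hk := by
    have : Algebra.adjoin ℂ (Set.range γ) ≤ Subalgebra.centralizer ℂ {relEplus b f} :=
      Algebra.adjoin_le (by
        rintro _ ⟨g, rfl⟩
        exact (Subalgebra.mem_centralizer_iff ℂ).2 (by simpa using (h.γ_mul_Eplus b g).symm))
    rw [rightComm_apply, (Subalgebra.mem_centralizer_iff ℂ).1 (this hk) _ rfl, sub_self]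
  vK k hk := by
    have : Algebra.adjoin ℂ (Set.range γ) ≤ Subalgebra.centralizer ℂ {relEminus b d} :=
      Algebra.adjoin_le (by
        rintro _ ⟨g, rfl⟩
        exact (Subalgebra.mem_centralizer_iff ℂ).2 (by simpa using (h.γ_mul_Eminus b g).symm))
    rw [rightComm_apply, (Subalgebra.mem_centralizer_iff ℂ).1 (this hk) _ rfl, sub_self]

theorem commute_Z_Eplus : Commute (relZ b f d) (relEplus b f) := by
  have := (h.slTwoData b).rightComm_u_z
  rw [rightComm_apply, sub_eq_zero] at this
  exact Commute.smul_left this _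

theorem commute_Z_Eminus : Commute (relZ b f d) (relEminus b d) := by
  have := (h.slTwoData b).rightComm_v_z
  rw [rightComm_apply, sub_eq_zero] at this
  exact Commute.smul_left this _

theorem commute_Zt_Eplus : Commute (relZt b c f d γ ε) (relEplus b f) :=
  by
  have : Commute (relSigma c γ) (relEplus b f) :=
    Commute.sum_left _ _ _ fun s _ => Commute.smul_left (h.γ_mul_Eplus b s) _
  exact (h.commute_Z_Eplus b).add_left (this.smul_left _)

theorem commute_Zt_Eminus : Commute (relZt b c f d γ ε) (relEminus b d) :=
  by
  have : Commute (relSigma c γ) (relEminus b d) :=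
    Commute.sum_left _ _ _ fun s _ => Commute.smul_left (h.γ_mul_Eminus b s) _
  exact (h.commute_Z_Eminus b).add_left (this.smul_left _)

/-- Commuting with `E₊` and `E₋` implies commuting with `H`. -/
theorem commute_H {a : R} (hp : Commute a (relEplus b f)) (hm : Commute a (relEminus b d)) :
    Commute a (relH b c f d γ) := by
  rw [h.relH_eq b]
  exact (hp.mul_right hm).sub_right (hm.mul_right hp)

-- The span N of the elements Ωᵏg and ΩᵏZ̃₀g contains 1 and is stable under left multiplication by
-- Z₀ and by G. It therefore contains the algebra they generate. At most one factor Z̃₀ is needed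
-- because Z₀Z̃₀ reduces to Ω, σ² and Z̃₀σ.
include hc in
theorem exists_normal_form [Fintype G] {a : R}
    (ha : a ∈ Algebra.adjoin ℂ (insert (f (b 0) * d (b 1) - f (b 1) * d (b 0))
      (Algebra.adjoin ℂ (Set.range γ) : Set R))) :
    ∃ P Q : G → Polynomial ℂ, a = ∑ g, (Polynomial.aeval (relOmega b c f d γ) (P g)
      + Polynomial.aeval (relOmega b c f d γ) (Q g) * relZt b c f d γ ε) * γ g := by
  set Ω := relOmega b c f d γ with hΩ
  set Zt := relZt b c f d γ ε with hZt
  set Z := relZ b f d with hZ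
  set σ := relSigma c γ with hσ
  let N : Submodule ℂ R := Submodule.span ℂ
    ({r | ∃ (k : ℕ) (g : G), r = Ω ^ k * γ g} ∪ {r | ∃ (k : ℕ) (g : G), r = Ω ^ k * Zt * γ g})
  have hmem : ∀ (r : R), (∀ g, r * γ g ∈ N) → ∀ u ∈ Algebra.adjoin ℂ (Set.range γ), r * u ∈ N := by
    intro r hr u hu
    have hu' : u ∈ Submodule.span ℂ (Set.range γ) := by
      rw [← toSubmodule_adjoin_range]; exact hu
    rw [← LinearMap.mulLeft_apply (R := ℂ), ← Submodule.mem_comap]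
    refine Submodule.span_le.2 ?_ hu'
    rintro _ ⟨g, rfl⟩
    exact hr g
  have hN1 : ∀ (k : ℕ), ∀ u ∈ Algebra.adjoin ℂ (Set.range γ), Ω ^ k * u ∈ N := fun k =>
    hmem _ fun g => Submodule.subset_span (Or.inl ⟨k, g, rfl⟩)
  have hN2 : ∀ (k : ℕ), ∀ u ∈ Algebra.adjoin ℂ (Set.range γ), Ω ^ k * Zt * u ∈ N := fun k =>
    hmem _ fun g => Submodule.subset_span (Or.inr ⟨k, g, rfl⟩)
  have hγ := γ_mem_adjoin γ
  have hσK : σ ∈ Algebra.adjoin ℂ (Set.range γ) := relSigma_mem_adjoin c γ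
  have hind : ∀ r : R, (∀ k g, r * (Ω ^ k * γ g) ∈ N) → (∀ k g, r * (Ω ^ k * Zt * γ g) ∈ N) →
      ∀ w ∈ N, r * w ∈ N := by
    intro r h1 h2 w hw
    rw [← LinearMap.mulLeft_apply (R := ℂ), ← Submodule.mem_comap]
    refine Submodule.span_le.2 ?_ hw
    rintro _ (⟨k, g, rfl⟩ | ⟨k, g, rfl⟩)
    exacts [h1 k g, h2 k g]
  have hZeq : Z = Zt - (ε : ℂ) • σ := by rw [hZt, relZt, add_sub_cancel_right]
  have hZN : ∀ w ∈ N, Z * w ∈ N := by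
    have hcz : ∀ k : ℕ, Z * Ω ^ k = Ω ^ k * Z := fun k =>
      ((h.omega_commute_Z b).symm.pow_right k)
    refine hind Z (fun k g => ?_) fun k g => ?_
    · have : Z * (Ω ^ k * γ g) = Ω ^ k * Zt * γ g - (ε : ℂ) • (Ω ^ k * (σ * γ g)) := by
        rw [← mul_assoc, hcz, hZeq]
        simp only [mul_sub, sub_mul, mul_smul_comm, smul_mul_assoc, mul_assoc]
      rw [this]
      exact N.sub_mem (hN2 k _ (hγ g)) (N.smul_mem _ (hN1 k _ (mul_mem hσK (hγ g))))
    · have : Z * (Ω ^ k * Zt * γ g) = Ω ^ (k + 1) * γ g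
          - (1 + (ε : ℂ) ^ 2) • (Ω ^ k * (σ ^ 2 * γ g)) + (ε : ℂ) • (Ω ^ k * Zt * (σ * γ g)) := by
        have e := Z_mul_Zt (c := c) (f := f) (d := d) (γ := γ) b ε
        rw [← mul_assoc, ← mul_assoc, hcz, mul_assoc (Ω ^ k) Z Zt, hZ, hZt, e]
        simp only [mul_add, mul_sub, sub_mul, add_mul, mul_smul_comm, smul_mul_assoc, mul_assoc,
          pow_succ, hΩ, hσ]
      rw [this]
      exact N.add_mem (N.sub_mem (hN1 _ _ (hγ g))
        (N.smul_mem _ (hN1 k _ (mul_mem (pow_mem hσK 2) (hγ g)))))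
        (N.smul_mem _ (hN2 k _ (mul_mem hσK (hγ g))))
  have hγN : ∀ g : G, ∀ w ∈ N, γ g * w ∈ N := by
    intro g
    have hcγ : ∀ k : ℕ, γ g * Ω ^ k = Ω ^ k * γ g := fun k =>
      ((h.omega_commute_γ hc b g).symm.pow_right k)
    refine hind (γ g) (fun k g' => ?_) fun k g' => ?_
    · rw [← mul_assoc, hcγ, mul_assoc]
      exact hN1 k _ (mul_mem (hγ g) (hγ g'))
    · rw [← mul_assoc, ← mul_assoc, hcγ, mul_assoc (Ω ^ k)]
      rcases isRot_or_isRef b g with hg | hg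
      · rw [hZt, h.γ_mul_Zt_of_isRot hc b ε hg, ← hZt, ← mul_assoc, mul_assoc]
        exact hN2 k _ (mul_mem (hγ g) (hγ g'))
      -- Conjugation by an orientation reversing g sends Z̃₀ = Z₀ + εσ to -Z₀ + εσ = 2εσ - Z̃₀.
      · have : Ω ^ k * (γ g * Zt) * γ g' = (2 * (ε : ℂ)) • (Ω ^ k * (σ * (γ g * γ g')))
            - Ω ^ k * Zt * (γ g * γ g') := by
          rw [hZt, h.γ_mul_Zt_of_isRef hc b ε hg, ← hZt, ← hZ, hZeq]
          simp only [mul_sub, sub_mul, mul_smul_comm, smul_mul_assoc, mul_assoc, smul_sub]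
          module
        rw [this]
        exact N.sub_mem (N.smul_mem _ (hN1 k _ (mul_mem hσK (mul_mem (hγ g) (hγ g')))))
          (hN2 k _ (mul_mem (hγ g) (hγ g')))
  have hlast : ∀ w ∈ N, a * w ∈ N := by
    have hK : ∀ u ∈ Algebra.adjoin ℂ (Set.range γ), ∀ w ∈ N, u * w ∈ N := by
      intro u hu
      have hu' : u ∈ Submodule.span ℂ (Set.range γ) := by
        rw [← toSubmodule_adjoin_range]; exact hu
      intro w hw
      rw [← LinearMap.mulRight_apply (R := ℂ), ← Submodule.mem_comap]
      refine Submodule.span_le.2 ?_ hu'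
      rintro _ ⟨g, rfl⟩
      exact hγN g w hw
    have hz : f (b 0) * d (b 1) - f (b 1) * d (b 0) = (-Complex.I) • Z := by
      rw [hZ, relZ, smul_smul, neg_mul, Complex.I_mul_I, neg_neg, one_smul]
    induction ha using Algebra.adjoin_induction with
    | mem r hr =>
      rcases hr with rfl | hr
      · intro w hw
        rw [hz, smul_mul_assoc]
        exact N.smul_mem _ (hZN w hw)
      · exact hK r hr
    | algebraMap t => exact fun w hw => by rw [← Algebra.smul_def]; exact N.smul_mem _ hw
    | add r s _ _ hr hs => exact fun w hw => by rw [add_mul]; exact N.add_mem (hr w hw) (hs w hw)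
    | mul r s _ _ hr hs => exact fun w hw => by rw [mul_assoc]; exact hr _ (hs w hw)
  have haN : a ∈ N := by
    have h1 : (1 : R) ∈ N := by simpa using hN1 0 1 (one_mem _)
    simpa using hlast 1 h1
  classical
  clear ha hlast
  induction haN using Submodule.span_induction with
  | mem r hr =>
    rcases hr with ⟨k, g, rfl⟩ | ⟨k, g, rfl⟩
    · refine ⟨Pi.single g (Polynomial.X ^ k), 0, ?_⟩
      rw [Finset.sum_eq_single g (fun g' _ hg' => by simp [Pi.single_eq_of_ne hg'])
        (fun hg => absurd (Finset.mem_univ g) hg)]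
      simp
    · refine ⟨0, Pi.single g (Polynomial.X ^ k), ?_⟩
      rw [Finset.sum_eq_single g (fun g' _ hg' => by simp [Pi.single_eq_of_ne hg'])
        (fun hg => absurd (Finset.mem_univ g) hg)]
      simp
  | zero => exact ⟨0, 0, by simp⟩
  | add r s _ _ hr hs =>
    obtain ⟨P, Q, h1⟩ := hr
    obtain ⟨P', Q', h2⟩ := hs
    refine ⟨P + P', Q + Q', ?_⟩
    rw [h1, h2, ← Finset.sum_add_distrib]
    refine Finset.sum_congr rfl fun g _ => ?_
    simp only [Pi.add_apply, map_add, add_mul]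
    abel
  | smul t r _ hr =>
    obtain ⟨P, Q, h1⟩ := hr
    refine ⟨t • P, t • Q, ?_⟩
    rw [h1, Finset.smul_sum]
    refine Finset.sum_congr rfl fun g _ => ?_
    simp only [Pi.smul_apply, map_smul, smul_mul_assoc, smul_add, add_mul]

include hc in
/-- The centraliser of `E₊`, `E₋` and `Z₀ + ε σ`, given the polynomial representation. -/
theorem mem_adjoin_Zt [Finite G]
    (ρ : R →ₐ[ℂ] Module.End ℂ (MvPolynomial (Fin 2) ℂ))
    (hf : ∀ w, ρ (f w) = LinearMap.mulLeft ℂ (lin b w)) (hd : ∀ w, ρ (d w) = dunkl b c w)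
    (hγ : ∀ g, ρ (γ g) = actHom b g)
    (hgen : Algebra.adjoin ℂ (Set.range f ∪ Set.range d ∪ Set.range γ) = ⊤) {a : R}
    (hp : Commute a (relEplus b f)) (hm : Commute a (relEminus b d))
    (hz : Commute a (relZt b c f d γ ε)) :
    a ∈ Algebra.adjoin ℂ (insert (relZt b c f d γ ε)
      {r | ∃ g : G, IsRot b (g : E ≃ₗᵢ[ℝ] E) ∧ r = γ g}) := by
  classical
  have := Fintype.ofFinite G
  have hgen' : Algebra.adjoin ℂ ({f (b 0), f (b 1), d (b 0), d (b 1)} ∪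
      (Algebra.adjoin ℂ (Set.range γ) : Set R)) = ⊤ := by
    rw [eq_top_iff, ← hgen]
    have hspan : Submodule.span ℂ {f (b 0), f (b 1), d (b 0), d (b 1)} ≤
        Subalgebra.toSubmodule (Algebra.adjoin ℂ ({f (b 0), f (b 1), d (b 0), d (b 1)} ∪
          (Algebra.adjoin ℂ (Set.range γ) : Set R))) :=
      Submodule.span_le.2 fun r hr => Algebra.subset_adjoin (Or.inl hr)
    refine Algebra.adjoin_le ?_
    rintro _ ((⟨w, rfl⟩ | ⟨w, rfl⟩) | ⟨g, rfl⟩)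
    exacts [hspan (h.f_mem_span b w), hspan (h.d_mem_span b w),
      Algebra.subset_adjoin (Or.inr (γ_mem_adjoin γ g))]
  obtain ⟨P, Q, hPQ⟩ := h.exists_normal_form hc b ε
    ((h.slTwoData b).mem_adjoin_of_commute hgen' hp hm)
  set Ω := relOmega b c f d γ with hΩ
  set Zt := relZt b c f d γ ε with hZt
  set Z := relZ b f d with hZ
  set B := Algebra.adjoin ℂ (insert Zt {r | ∃ g : G, IsRot b (g : E ≃ₗᵢ[ℝ] E) ∧ r = γ g}) with hB
  let U : G → R := fun g => Polynomial.aeval Ω (P g) + Polynomial.aeval Ω (Q g) * Zt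
  have hZtB : Zt ∈ B := Algebra.subset_adjoin (Set.mem_insert _ _)
  have hγB : ∀ g : G, IsRot b (g : E ≃ₗᵢ[ℝ] E) → γ g ∈ B := fun g hg =>
    Algebra.subset_adjoin (Set.mem_insert_of_mem _ ⟨g, hg, rfl⟩)
  -- A product of two reflections is a rotation, so σ² lies in the algebra of rotations although σ
  -- need not.
  have hσB : relSigma c γ ^ 2 ∈ B := by
    rw [sq, relSigma, Finset.sum_mul_sum]
    refine sum_mem fun s _ => sum_mem fun t _ => ?_
    rw [smul_mul_smul_comm, ← map_mul]
    exact Subalgebra.smul_mem _ (hγB _ ((isRef_reflection b s).mul b (isRef_reflection b t))) _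
  have hΩB : Ω ∈ B := by
    have : Ω = Zt ^ 2 - ((ε : ℂ) ^ 2 - 1) • relSigma c γ ^ 2 := by
      rw [hZt, h.Zt_sq, add_sub_cancel_right]
    rw [this]
    exact sub_mem (pow_mem hZtB 2) (Subalgebra.smul_mem _ hσB _)
  have hUB : ∀ g, U g ∈ B := fun g => by
    have : ∀ T : Polynomial ℂ, Polynomial.aeval Ω T ∈ B := fun T =>
      Algebra.adjoin_le (Set.singleton_subset_iff.2 hΩB)
        (Polynomial.aeval_mem_adjoin_singleton ℂ Ω)
    exact add_mem (this _) (mul_mem (this _) hZtB)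
  have hUZt : ∀ g, Commute (U g) Zt := fun g =>
    Commute.add_left (commute_aeval (h.omega_commute_Zt b ε).symm _).symm
      ((commute_aeval (h.omega_commute_Zt b ε).symm _).symm.mul_left (Commute.refl _))
  have hsplit : a = ∑ g : {g : G // IsRot b (g : E ≃ₗᵢ[ℝ] E)}, U g.1 * γ g.1
      + ∑ g : {g : G // IsRef b (g : E ≃ₗᵢ[ℝ] E)}, U g.1 * γ g.1 := by
    rw [hPQ, ← Fintype.sum_subtype_add_sum_subtype (fun g : G => IsRot b (g : E ≃ₗᵢ[ℝ] E))]
    congr 1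
    refine Fintype.sum_equiv (Equiv.subtypeEquivRight fun g => ?_) _ _ fun g => rfl
    exact (isRef_iff_not_isRot b _).symm
  have h0B : ∑ g : {g : G // IsRot b (g : E ≃ₗᵢ[ℝ] E)}, U g.1 * γ g.1 ∈ B :=
    sum_mem fun g _ => mul_mem (hUB _) (hγB _ g.2)
  have h0Zt : Commute (∑ g : {g : G // IsRot b (g : E ≃ₗᵢ[ℝ] E)}, U g.1 * γ g.1) Zt :=
    Commute.sum_left _ _ _ fun g _ => (hUZt _).mul_left (h.γ_mul_Zt_of_isRot hc b ε g.2)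
  set a₁ := ∑ g : {g : G // IsRef b (g : E ≃ₗᵢ[ℝ] E)}, U g.1 * γ g.1 with ha₁
  have h1Zt : a₁ * Zt = Zt * a₁ := by
    have : a₁ = a - ∑ g : {g : G // IsRot b (g : E ≃ₗᵢ[ℝ] E)}, U g.1 * γ g.1 := by
      rw [hsplit, add_sub_cancel_left]
    rw [this]
    exact hz.sub_left h0Zt
  -- The coefficients U g commute with Z̃₀, and gZ̃₀ = (Z̃₀ - 2Z₀)g with gZ₀ = -Z₀g. The commutator
  -- of a₁ with Z̃₀ is thus 2 a₁ Z₀.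
  have h1Z : a₁ * Z = 0 := by
    have e : a₁ * Zt - Zt * a₁ = (2 : ℂ) • (a₁ * Z) := by
      rw [ha₁, Finset.sum_mul, Finset.mul_sum, Finset.sum_mul, ← Finset.sum_sub_distrib,
        Finset.smul_sum]
      refine Finset.sum_congr rfl fun g _ => ?_
      rw [mul_assoc, mul_assoc (U _) _ Z, h.γ_mul_Zt_of_isRef hc b ε g.2,
        h.γ_mul_Z_of_isRef b g.2, ← mul_assoc Zt, ← (hUZt g.1).eq, sub_mul, mul_sub, smul_mul_assoc,
        mul_smul_comm, mul_neg, smul_neg, mul_assoc (U g.1) Zt]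
      abel
    rw [h1Zt, sub_self] at e
    exact (smul_eq_zero.1 e.symm).resolve_left two_ne_zero
  have hρZ : ρ Z = opZ b c := by
    simp only [hZ, relZ, opZ, map_smul, map_sub, map_mul, hf, hd]
  have hρσ : ρ (relSigma c γ) = opSigma b c := by
    simp only [relSigma, opSigma, map_sum, map_smul, hγ]
  have hρΩ : ρ Ω = opOmega b c := by
    rw [hΩ, relOmega, map_add, map_pow, map_pow, hρσ, ← hZ, hρZ]; rfl
  have hρZt : ρ Zt = opZt b c ε := by
    rw [hZt, relZt, map_add, map_smul, hρσ, ← hZ, hρZ]; rfl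
  have hvan := eq_zero_of_mul_opZ_eq_zero b c hc ε Nat.card_pos.ne' (fun g => P g.1)
    (fun g => Q g.1) (by
      rw [← map_zero ρ, ← h1Z, map_mul, hρZ, ha₁, map_sum]
      congr 1
      refine Finset.sum_congr rfl fun g _ => ?_
      simp only [U, map_mul, map_add, hγ, hρZt, ← Polynomial.aeval_algHom_apply, hρΩ])
  have h1 : a₁ = 0 := Finset.sum_eq_zero fun g _ => by
    simp [U, (hvan g).1, (hvan g).2]
  rw [hsplit, h1, add_zero]
  exact h0B

end CherednikRel
end Centraliser

/-! ### Transfer to `RCA` and its universal property. -/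

section Presentation

variable {E : Type*} [NormedAddCommGroup E] [InnerProductSpace ℝ E]
variable (G : Subgroup (E ≃ₗᵢ[ℝ] E)) (c : reflections G → ℂ)

/-- The element of `H_c(G, E)` given by the covector `⟪w, ·⟫`. -/
def covE (w : E) : RCA G c := cov G c (innerₗ E w)

theorem contragredient_innerₗ (g : E ≃ₗᵢ[ℝ] E) (w : E) :
    contragredient g (innerₗ E w) = innerₗ E (g w) := by
  ext z
  change inner ℝ w (g.symm z) = inner ℝ (g w) z
  rw [← g.inner_map_map, g.apply_symm_apply]

variable [Fintype (reflections G)]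

/-- The right hand side of the commutation relation between vectors and covectors. -/
theorem rel_vec_cov_image {R : Type*} [Ring R] [Algebra ℂ R] (φ : FreeAlgebra ℂ (Gen G) →ₐ[ℂ] R)
    (w z : E) : φ (algebraMap ℂ _ ((innerₗ E z w : ℝ) : ℂ) -
          (2 : ℂ) • ∑ᶠ s : reflections G,
            (((innerₗ E z (root s) * coroot s w / coroot s (root s) : ℝ) : ℂ) * c s) •
              fgrp (s : G))
      = ((inner ℝ z w : ℝ) : ℂ) • (1 : R)
        - ∑ s : reflections G, (((inner ℝ z (w - ((s : G) : E ≃ₗᵢ[ℝ] E) w) : ℝ) : ℂ) * c s) •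
            φ (fgrp (s : G)) := by
  rw [finsum_eq_sum_of_fintype, map_sub, AlgHom.commutes, Algebra.algebraMap_eq_smul_one, map_smul,
    map_sum, Finset.smul_sum]
  congr 1
  refine Finset.sum_congr rfl fun s _ => ?_
  rw [← root_coeff, map_smul, smul_smul]
  congr 1
  simp only [coroot, innerₗ_apply_apply]
  push_cast
  ring

theorem cherednikRel_RCA : CherednikRel c (covE G c) (vec G c) (grp G c) where
  f_add w z := by
    change RingQuot.mkAlgHom ℂ (Rel G c) (fcov G (innerₗ E (w + z))) = _
    rw [map_add (innerₗ E), RingQuot.mkAlgHom_rel ℂ (Rel.cov_add (c := c) _ _), map_add]; rfl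
  f_smul r w := by
    change RingQuot.mkAlgHom ℂ (Rel G c) (fcov G (innerₗ E (r • w))) = _
    rw [map_smul (innerₗ E), RingQuot.mkAlgHom_rel ℂ (Rel.cov_smul (c := c) r _), map_smul]; rfl
  d_add w z := by
    change RingQuot.mkAlgHom ℂ (Rel G c) (fvec G (w + z)) = _
    rw [RingQuot.mkAlgHom_rel ℂ (Rel.vec_add (c := c) w z), map_add]; rfl
  d_smul r w := by
    change RingQuot.mkAlgHom ℂ (Rel G c) (fvec G (r • w)) = _
    rw [RingQuot.mkAlgHom_rel ℂ (Rel.vec_smul (c := c) r w), map_smul]; rfl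
  f_mul_f w z := by
    have := RingQuot.mkAlgHom_rel ℂ (Rel.cov_comm (c := c) (innerₗ E w) (innerₗ E z))
    rwa [map_mul, map_mul] at this
  d_mul_d w z := by
    have := RingQuot.mkAlgHom_rel ℂ (Rel.vec_comm (c := c) w z)
    rwa [map_mul, map_mul] at this
  γ_mul_f g w := by
    have := RingQuot.mkAlgHom_rel ℂ (Rel.grp_cov (c := c) g (innerₗ E w))
    rwa [contragredient_innerₗ, map_mul, map_mul] at this
  γ_mul_d g w := by
    have := RingQuot.mkAlgHom_rel ℂ (Rel.grp_vec (c := c) g w)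
    rwa [map_mul, map_mul] at this
  d_comm_f w z := by
    have := RingQuot.mkAlgHom_rel ℂ (Rel.vec_cov (c := c) w (innerₗ E z))
    rwa [rel_vec_cov_image, map_sub, map_mul, map_mul] at this

variable (b : OrthonormalBasis (Fin 2) ℝ E)

/-- The vector representing a covector. -/
def riesz : Module.Dual ℝ E →ₗ[ℝ] E where
  toFun x := x (b 0) • b 0 + x (b 1) • b 1
  map_add' x y := by simp only [LinearMap.add_apply]; module
  map_smul' r x := by simp only [LinearMap.smul_apply, RingHom.id_apply, smul_eq_mul]; module

theorem riesz_innerₗ (w : E) : riesz b (innerₗ E w) = w := by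
  change inner ℝ w (b 0) • b 0 + inner ℝ w (b 1) • b 1 = w
  rw [real_inner_comm, real_inner_comm (b 1), basis_expansion]

theorem innerₗ_riesz (x : Module.Dual ℝ E) : innerₗ E (riesz b x) = x := by
  refine b.toBasis.ext fun i => ?_
  fin_cases i <;> simp [riesz, inner_add_left, inner_smul_left]

variable {G c}

/-- The images of the generators under a homomorphism. -/
def genMap {R : Type*} [Ring R] [Algebra ℂ R] (f d : E → R) (γ : G →* R) : Gen G → R
  | Gen.vec w => d w
  | Gen.cov x => f (riesz b x)
  | Gen.grp g => γ g

include b in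
/-- The homomorphism from `H_c(G, E)` given by elements which satisfy its relations. -/
theorem CherednikRel.exists_lift {R : Type*} [Ring R] [Algebra ℂ R] {f d : E → R} {γ : G →* R}
    (h : CherednikRel c f d γ) : ∃ ρ : RCA G c →ₐ[ℂ] R, (∀ w, ρ (covE G c w) = f w) ∧
      (∀ w, ρ (vec G c w) = d w) ∧ ∀ g, ρ (grp G c g) = γ g := by
  set φ : FreeAlgebra ℂ (Gen G) →ₐ[ℂ] R := FreeAlgebra.lift ℂ (genMap b f d γ) with hφ
  have hd : ∀ w, φ (fvec G w) = d w := fun w => FreeAlgebra.lift_ι_apply _ _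
  have hf : ∀ x, φ (fcov G x) = f (riesz b x) := fun x => FreeAlgebra.lift_ι_apply _ _
  have hγ : ∀ g, φ (fgrp g) = γ g := fun g => FreeAlgebra.lift_ι_apply _ _
  have hrel : ∀ ⦃x y⦄, Rel G c x y → φ x = φ y := by
    intro x y hxy
    cases hxy with
    | vec_add w z => simp only [map_add, hd, h.d_add]
    | vec_smul r w => simp only [map_smul, hd, h.d_smul]
    | cov_add x y => simp only [map_add, hf, h.f_add]
    | cov_smul r x => simp only [map_smul, hf, h.f_smul]
    | grp_one => simp only [hγ, map_one]
    | grp_mul g k => simp only [hγ, map_mul]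
    | grp_vec g w => simp only [map_mul, hγ, hd, h.γ_mul_d]
    | grp_cov g x =>
      -- Every covector is an inner product, so the relations indexed by covectors reduce to those
      -- of `CherednikRel`.
      obtain ⟨w, rfl⟩ : ∃ w, x = innerₗ E w := ⟨_, (innerₗ_riesz b x).symm⟩
      rw [contragredient_innerₗ, map_mul, map_mul, hγ, hf, hf, riesz_innerₗ, riesz_innerₗ,
        h.γ_mul_f]
    | vec_comm w z => simp only [map_mul, hd, h.d_mul_d w z]
    | cov_comm x y => simp only [map_mul, hf, h.f_mul_f (riesz b x)]
    | vec_cov w x =>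
      obtain ⟨z, rfl⟩ : ∃ z, x = innerₗ E z := ⟨_, (innerₗ_riesz b x).symm⟩
      rw [rel_vec_cov_image, map_sub, map_mul, map_mul, hd, hf, riesz_innerₗ, h.d_comm_f]
      simp only [hγ]
  refine ⟨RingQuot.liftAlgHom ℂ ⟨φ, hrel⟩, fun w => ?_, fun w => ?_, fun g => ?_⟩
  · refine (RingQuot.liftAlgHom_mkAlgHom_apply ℂ φ hrel _).trans ?_
    rw [hf, riesz_innerₗ]
  · exact (RingQuot.liftAlgHom_mkAlgHom_apply ℂ φ hrel _).trans (hd w)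
  · exact (RingQuot.liftAlgHom_mkAlgHom_apply ℂ φ hrel _).trans (hγ g)

omit [Fintype (reflections G)] in
include b in
theorem adjoin_generators : Algebra.adjoin ℂ (Set.range (covE G c) ∪ Set.range (vec G c) ∪
    Set.range (grp G c)) = ⊤ := by
  rw [eq_top_iff]
  rintro r -
  obtain ⟨x, rfl⟩ := RingQuot.mkAlgHom_surjective ℂ (Rel G c) r
  have hx : x ∈ Algebra.adjoin ℂ (Set.range (FreeAlgebra.ι ℂ (X := Gen G))) := by
    rw [FreeAlgebra.adjoin_range_ι]; trivial
  induction hx using Algebra.adjoin_induction with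
  | mem x hx =>
    obtain ⟨g, rfl⟩ := hx
    refine Algebra.subset_adjoin ?_
    cases g with
    | vec w => exact Or.inl (Or.inr ⟨w, rfl⟩)
    | cov x =>
      refine Or.inl (Or.inl ⟨riesz b x, ?_⟩)
      change RingQuot.mkAlgHom ℂ (Rel G c) (fcov G (innerₗ E (riesz b x))) = _
      rw [innerₗ_riesz]; rfl
    | grp g => exact Or.inr ⟨g, rfl⟩
  | algebraMap t => rw [AlgHom.commutes]; exact Subalgebra.algebraMap_mem _ t
  | add x y _ _ hx hy => rw [map_add]; exact add_mem hx hy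
  | mul x y _ _ hx hy => rw [map_mul]; exact mul_mem hx hy

variable (G c)

omit [Fintype (reflections G)] in
theorem elX_eq : elX G c b = covE G c (b 0) := by
  rw [elX, covE]; congr 1; ext w
  simp [OrthonormalBasis.repr_apply_apply]

omit [Fintype (reflections G)] in
theorem elY_eq : elY G c b = covE G c (b 1) := by
  rw [elY, covE]; congr 1; ext w
  simp [OrthonormalBasis.repr_apply_apply]

theorem sigma_eq : sigma G c = relSigma c (grp G c) := finsum_eq_sum_of_fintype _

omit [Fintype (reflections G)] in
theorem Eplus_eq : Eplus G c b = relEplus b (covE G c) := by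
  rw [Eplus, elX_eq, elY_eq]; rfl

omit [Fintype (reflections G)] in
theorem Eminus_eq : Eminus G c b = relEminus b (vec G c) := rfl

theorem elH_eq : elH G c b = relH b c (covE G c) (vec G c) (grp G c) := by
  rw [elH, elX_eq, elY_eq, sigma_eq]; rfl

theorem Ztilde_eq (ε : ℝ) :
    Ztilde G c b ε = relZt b c (covE G c) (vec G c) (grp G c) ε := by
  rw [Ztilde, Zzero, elX_eq, elY_eq, sigma_eq]; rfl

variable {G c}

omit [Fintype (reflections G)] in
theorem grp_mem_groupAlgebra {K : Subgroup G} {g : G} (hg : g ∈ K) :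
    grp G c g ∈ groupAlgebra G c K :=
  ⟨MonoidAlgebra.of ℂ K ⟨g, hg⟩, by simp⟩

omit [Fintype (reflections G)] in
theorem groupAlgebra_le {K : Subgroup G} {S : Subalgebra ℂ (RCA G c)}
    (hS : ∀ g ∈ K, grp G c g ∈ S) : groupAlgebra G c K ≤ S := by
  rintro _ ⟨x, rfl⟩
  change MonoidAlgebra.lift ℂ (RCA G c) K ((grp G c).comp K.subtype) x ∈ S
  rw [MonoidAlgebra.lift_apply]
  exact sum_mem fun g _ => Subalgebra.smul_mem _ (hS g.1 g.2) _

omit [Fintype (reflections G)] in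
theorem commute_of_mem_u11 {ε : ℝ} {a t : RCA G c} (hp : Commute a (Eplus G c b))
    (hm : Commute a (Eminus G c b)) (hH : Commute a (elH G c b)) (hz : Commute a (Ztilde G c b ε))
    (ht : t ∈ u11 G c b ε) : Commute a t := by
  induction ht using LieSubalgebra.lieSpan_induction with
  | mem x hx =>
    rcases hx with rfl | rfl | rfl | rfl
    exacts [hp, hm, hH, hz]
  | zero => exact Commute.zero_right a
  | add x y _ _ hx hy => exact Commute.add_right hx hy
  | smul r x _ hx => exact Commute.smul_right hx r
  | lie x y _ _ hx hy => exact Commute.sub_right (hx.mul_right hy) (hy.mul_right hx)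

end Presentation

/-! ### The subgroup commuting with J. -/

section RotationSubgroup

variable {E : Type*} [NormedAddCommGroup E] [InnerProductSpace ℝ E]
variable (b : OrthonormalBasis (Fin 2) ℝ E)

theorem zc_map_of_isRot {g : E ≃ₗᵢ[ℝ] E} (hg : IsRot b g) (w : E) :
    zc b (g w) = zc b (g (b 0)) * zc b w := by
  conv_lhs => rw [← basis_expansion b w]
  rw [map_add, map_smul, map_smul, map_add, map_smul, map_smul, zc_of_isRot b hg, zc_apply b w]
  simp only [Complex.real_smul]
  ring

theorem zc_injective : Function.Injective (zc b) := by
  intro w z h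
  by_contra hne
  exact zc_ne_zero b (sub_ne_zero.2 hne) (by rw [map_sub, h, sub_self])

variable {J : E →ₗ[ℝ] E} (hb₀ : J (b 0) = -b 1) (hb₁ : J (b 1) = b 0)
variable (G : Subgroup (E ≃ₗᵢ[ℝ] E))
include hb₀ hb₁

theorem zc_J (w : E) : zc b (J w) = -Complex.I * zc b w := by
  conv_lhs => rw [← basis_expansion b w]
  rw [map_add, map_smul, map_smul, hb₀, hb₁, map_add, map_smul, map_smul, map_neg, zc_zero, zc_one,
    zc_apply b w]
  simp only [Complex.real_smul]
  linear_combination (((inner ℝ (b 1) w : ℝ) : ℂ)) * Complex.I_sq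

/-- In the coordinate `zc`, J is multiplication by -i. Rotations are complex linear and commute with
it. An orientation reversing isometry is antilinear and would have a vector of norm 1 equal to its
negative. -/
theorem mem_commutingSubgroup_iff (g : G) :
    g ∈ commutingSubgroup G J ↔ IsRot b (g : E ≃ₗᵢ[ℝ] E) := by
  have hdef : g ∈ commutingSubgroup G J ↔
      ∀ v : E, (g : E ≃ₗᵢ[ℝ] E) (J v) = J ((g : E ≃ₗᵢ[ℝ] E) v) := Iff.rfl
  rw [hdef]
  constructor
  · intro hg
    refine (isRot_or_isRef b _).resolve_right fun hr => ?_
    have h1 := congrArg (zc b) (hg (b 1))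
    rw [hb₁, zc_J b hb₀ hb₁, zc_of_isRef b hr, ← mul_assoc, neg_mul_neg, Complex.I_mul_I,
      neg_one_mul] at h1
    have h2 := norm_zc b (g : E ≃ₗᵢ[ℝ] E)
    rw [self_eq_neg.1 h1, norm_zero] at h2
    exact zero_ne_one h2
  · intro hg v
    apply zc_injective b
    rw [zc_J b hb₀ hb₁, zc_map_of_isRot b hg, zc_map_of_isRot b hg v, zc_J b hb₀ hb₁]
    ring

/-- The multiplier of a rotation is a faithful character, and a finite group of units of a field is
cyclic. -/
theorem isCyclic_commutingSubgroup [Finite G] : IsCyclic (commutingSubgroup G J) := by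
  have hrot : ∀ g : commutingSubgroup G J, IsRot b ((g : G) : E ≃ₗᵢ[ℝ] E) := fun g =>
    (mem_commutingSubgroup_iff b hb₀ hb₁ G g).1 g.2
  let φ : commutingSubgroup G J →* ℂ :=
    { toFun := fun g => zc b (((g : G) : E ≃ₗᵢ[ℝ] E) (b 0))
      map_one' := zc_zero b
      map_mul' := fun g k => zc_map_of_isRot b (hrot g) _ }
  refine isCyclic_of_injective_ringHom φ fun g k h => ?_
  refine Subtype.ext (Subtype.ext (LinearIsometryEquiv.ext fun w => zc_injective b ?_))
  rw [zc_map_of_isRot b (hrot g), zc_map_of_isRot b (hrot k)]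
  exact congrArg (· * zc b w) h

/-- The order is at least 2, so a group generated by reflections must contain one. Multiplication by
it exchanges rotations with the other elements, and the rotations have index 2. -/
theorem card_commutingSubgroup (hG : IsGeneratedByReflections G) {m : ℕ} (hm : 1 ≤ m)
    (hGm : Nat.card G = 2 * m) : Nat.card (commutingSubgroup G J) = m := by
  obtain ⟨s, hs⟩ : (reflections G).Nonempty := by
    rw [Set.nonempty_iff_ne_empty]
    intro h0
    have : Subsingleton G := by
      rw [← Subgroup.subsingleton_iff, ← subsingleton_iff_bot_eq_top, ← Subgroup.closure_empty, ← h0]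
      exact hG
    have := Nat.card_of_subsingleton (1 : G)
    omega
  have hsr : IsRef b (s : E ≃ₗᵢ[ℝ] E) := isRef_reflection b ⟨s, hs⟩
  have hidx : (commutingSubgroup G J).index = 2 := by
    rw [Subgroup.index_eq_two_iff_exists_notMem_and]
    refine ⟨s, ?_, fun g => ?_⟩
    · rw [mem_commutingSubgroup_iff b hb₀ hb₁]
      exact (isRef_iff_not_isRot b _).1 hsr
    · rw [mem_commutingSubgroup_iff b hb₀ hb₁, mem_commutingSubgroup_iff b hb₀ hb₁]
      rcases isRot_or_isRef b (g : E ≃ₗᵢ[ℝ] E) with h | h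
      · exact Or.inr h
      · exact Or.inl (h.mul b hsr)
  have := (commutingSubgroup G J).card_mul_index
  rw [hidx, hGm] at this
  omega

end RotationSubgroup
end Cherednik

end

theorem propositionp
    {E : Type*} [NormedAddCommGroup E] [InnerProductSpace ℝ E]
    -- a complex structure on the Euclidean plane `E`, and an adapted orthonormal basis `(ξ, η)`
    (J : E →ₗ[ℝ] E) (hJ : Cherednik.IsComplexStructure J)
    (b : OrthonormalBasis (Fin 2) ℝ E) (hb₀ : J (b 0) = -b 1) (hb₁ : J (b 1) = b 0)
    -- a dihedral reflection group of order `2 m`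
    (m : ℕ) (hm : 1 ≤ m) (G : Subgroup (E ≃ₗᵢ[ℝ] E))
    (hG : Cherednik.IsGeneratedByReflections G) (hGm : Nonempty (G ≃* DihedralGroup m))
    -- a conjugation invariant parameter on the reflections
    (c : Cherednik.reflections G → ℂ)
    (hc : ∀ s t : Cherednik.reflections G, IsConj (s : G) (t : G) → c s = c t)
    (ε : ℝ) :
    Subalgebra.centralizer ℂ (Cherednik.u11 G c b ε : Set (Cherednik.RCA G c)) =
        Algebra.adjoin ℂ
          ({Cherednik.Ztilde G c b ε} ∪
            (Cherednik.groupAlgebra G c (Cherednik.commutingSubgroup G J) :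
              Set (Cherednik.RCA G c))) ∧
      (∀ g : G, g ∈ Cherednik.commutingSubgroup G J ↔
        LinearMap.det ((g : E ≃ₗᵢ[ℝ] E).toLinearEquiv : E →ₗ[ℝ] E) = 1) ∧
      IsCyclic (Cherednik.commutingSubgroup G J) ∧
      Nat.card (Cherednik.commutingSubgroup G J) = m := by
  obtain ⟨e⟩ := hGm
  have hcard : Nat.card G = 2 * m := (Nat.card_congr e.toEquiv).trans DihedralGroup.nat_card
  have : Finite G := Nat.finite_of_card_ne_zero (by omega)
  have := Fintype.ofFinite (Cherednik.reflections G)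
  have hmem := Cherednik.mem_commutingSubgroup_iff b hb₀ hb₁ G
  refine ⟨le_antisymm ?_ ?_, fun g => (hmem g).trans (Cherednik.isRot_iff_det b _),
    Cherednik.isCyclic_commutingSubgroup b hb₀ hb₁ G,
    Cherednik.card_commutingSubgroup b hb₀ hb₁ G hG hm hcard⟩
  · intro a ha
    rw [Subalgebra.mem_centralizer_iff] at ha
    have hgen : ∀ t ∈ ({Cherednik.Eplus G c b, Cherednik.Eminus G c b, Cherednik.elH G c b,
        Cherednik.Ztilde G c b ε} : Set (Cherednik.RCA G c)), Commute a t := fun t ht =>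
      (ha t (LieSubalgebra.subset_lieSpan ht)).symm
    -- The Dunkl operators satisfy the relations, so they define a representation of the Cherednik
    -- algebra. Faithfulness is not required.
    obtain ⟨ρ, hf, hd, hγ⟩ := (Cherednik.cherednikRel_dunkl b c hc).exists_lift b
    have hp := hgen _ (Or.inl rfl)
    have hm' := hgen _ (Or.inr (Or.inl rfl))
    have hz := hgen _ (Or.inr (Or.inr (Or.inr rfl)))
    rw [Cherednik.Eplus_eq] at hp
    rw [Cherednik.Eminus_eq] at hm'
    rw [Cherednik.Ztilde_eq] at hz
    refine Algebra.adjoin_mono ?_ ((Cherednik.cherednikRel_RCA G c).mem_adjoin_Zt hc b ε ρ hf hd hγ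
      (Cherednik.adjoin_generators b) hp hm' hz)
    rintro _ (rfl | ⟨g, hg, rfl⟩)
    · exact Or.inl (Cherednik.Ztilde_eq G c b ε).symm
    · exact Or.inr (Cherednik.grp_mem_groupAlgebra ((hmem g).2 hg))
  · have h := Cherednik.cherednikRel_RCA G c
    -- Commutation with H follows from H = [E₊, E₋], so three generators suffice.
    have hcent : ∀ a : Cherednik.RCA G c, Commute a (Cherednik.Eplus G c b) →
        Commute a (Cherednik.Eminus G c b) → Commute a (Cherednik.Ztilde G c b ε) →
        a ∈ Subalgebra.centralizer ℂ (Cherednik.u11 G c b ε : Set (Cherednik.RCA G c)) := by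
      intro a hp hm' hz
      rw [Subalgebra.mem_centralizer_iff]
      intro t ht
      refine (Cherednik.commute_of_mem_u11 b hp hm' ?_ hz ht).symm
      rw [Cherednik.elH_eq]
      rw [Cherednik.Eplus_eq] at hp
      exact h.commute_H b hp hm'
    refine Algebra.adjoin_le (Set.union_subset (Set.singleton_subset_iff.2 ?_) ?_)
    · refine hcent _ ?_ ?_ (Commute.refl _)
      · rw [Cherednik.Ztilde_eq, Cherednik.Eplus_eq]; exact h.commute_Zt_Eplus b ε
      · rw [Cherednik.Ztilde_eq, Cherednik.Eminus_eq]; exact h.commute_Zt_Eminus b ε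
    · refine Cherednik.groupAlgebra_le fun g hg => hcent _ ?_ ?_ ?_
      · rw [Cherednik.Eplus_eq]; exact h.γ_mul_Eplus b g
      · rw [Cherednik.Eminus_eq]; exact h.γ_mul_Eminus b g
      · rw [Cherednik.Ztilde_eq]; exact h.γ_mul_Zt_of_isRot hc b ε ((hmem g).1 hg)
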